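/- Let $\mathbb{H}$ be the quaternions, $\mathbb{B}=\{q\in\mathbb{H}:|q|<1\}$ and $\mathbb{S}=\{I\in\mathbb{H}: I^2=-1\}$. A function $f:\mathbb{B}\to\mathbb{H}$ is slice regular if for every $I\in\mathbb{S}$ its restriction $f_I$ to $\mathbb{B}\cap(\mathbb{R}+\mathbb{R}I)$ has continuous partial derivatives and satisfies $\frac12\left(\frac{\partial}{\partial x}+I\frac{\partial}{\partial y}\right)f_I(x+yI)=0$; its slice derivative is $f'(x+yI)=\frac12\left(\frac{\partial}{\partial x}-I\frac{\partial}{\partial y}\right)f_I(x+yI)$. A slice regular function $f$ on $\mathbb{B}$ is slice starlike if $f(0)=0$, $f'(0)=1$, $f$ has no zero in $\mathbb{B}$ other than $0$, and $\mathrm{Re}\left(f(q)^{-1}qf'(q)\right)>0$ for all $q\in\mathbb{B}\setminus\{0\}$. Theorem. If $f(q)=q+\sum_{k=2}^{\infty}q^kp_k$ $(q\in\mathbb{B}$, $p_k\in\mathbb{H})$ is slice starlike, then $$|q|+\sum_{k=2}^{\infty}|q^kp_k|\le 1\qquad\text{for all } q\in\mathbb{H} \text{ with } |q|\le\frac{3-\sqrt5}{2}.$$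 The constant $\frac{3-\sqrt5}{2}$ cannot be improved. Indeed, for every $u\in\mathbb{H}$ with $|u|=1$ the quaternionic Koebe function $$f_u(q)=q(1-qu)^{-*2}=q+\sum_{k=2}^{\infty}q^k\,k\,u^{k-1}\qquad(q\in\mathbb{B})$$ is slice starlike, and $|q|+\sum_{k=2}^{\infty}|q^k\,k\,u^{k-1}|$ converges and is $>1$ for every $q$ with $\frac{3-\sqrt5}{2}<|q|<1$. Here, for power series $a(q)=\sum_k q^ka_k$ and $b(q)=\sum_k q^kb_k$, the regular product is $(a*b)(q)=\sum_k q^k\sum_{n=0}^k a_nb_{k-n}$, the regular conjugate is $a^c(q)=\sum_k q^k\overline{a_k}$, the regular reciprocal is $a^{-*}(q)=\left((a*a^c)(q)\right)^{-1}a^c(q)$, and $(1-qu)^{-*2}$ is the regular reciprocal of $(1-qu)*(1-qu)$. -/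

import Mathlib

open scoped Quaternion

noncomputable section

namespace SliceStarlike

/-- The sphere of imaginary units of the quaternions. -/
def imaginaryUnits : Set ℍ[ℝ] := {I | I * I = -1}

/-- The restriction `f_I` of `f` to the plane `ℝ + ℝ I`, as a function of the real
coordinates `(x, y)` of the point `x + y I`. -/
def restrict (f : ℍ[ℝ] → ℍ[ℝ]) (I : ℍ[ℝ]) : ℝ × ℝ → ℍ[ℝ] :=
  fun z => f ((z.1 : ℍ[ℝ]) + z.2 • I)

/-- The partial derivative in `x` of the restriction `f_I`. -/
def partialX (f : ℍ[ℝ] → ℍ[ℝ]) (I : ℍ[ℝ]) (z : ℝ × ℝ) : ℍ[ℝ] :=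
  fderiv ℝ (restrict f I) z (1, 0)

/-- The partial derivative in `y` of the restriction `f_I`. -/
def partialY (f : ℍ[ℝ] → ℍ[ℝ]) (I : ℍ[ℝ]) (z : ℝ × ℝ) : ℍ[ℝ] :=
  fderiv ℝ (restrict f I) z (0, 1)

/-- The operator `(1/2) (∂/∂x + I ∂/∂y)` applied to the restriction `f_I`. -/
def dbar (f : ℍ[ℝ] → ℍ[ℝ]) (I : ℍ[ℝ]) (z : ℝ × ℝ) : ℍ[ℝ] :=
  (1 / 2 : ℝ) • (partialX f I z + I * partialY f I z)

/-- The `I`-derivative `(1/2) (∂/∂x - I ∂/∂y)` of the restriction `f_I`. -/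
def dI (f : ℍ[ℝ] → ℍ[ℝ]) (I : ℍ[ℝ]) (z : ℝ × ℝ) : ℍ[ℝ] :=
  (1 / 2 : ℝ) • (partialX f I z - I * partialY f I z)

/-- The open unit disc of the plane `ℝ + ℝ I`, in the coordinates `(x, y)`. -/
def disc (I : ℍ[ℝ]) : Set (ℝ × ℝ) := {z | ‖(z.1 : ℍ[ℝ]) + z.2 • I‖ < 1}

/-- Slice regularity on the open unit ball: every restriction `f_I` is of class `C¹` (that is, has
continuous partial derivatives) on the open disc and satisfies the Cauchy-Riemann equation.
Only the values of `f` on the ball matter. -/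
def IsSliceRegular (f : ℍ[ℝ] → ℍ[ℝ]) : Prop :=
  ∀ I ∈ imaginaryUnits, ContDiffOn ℝ 1 (restrict f I) (disc I) ∧ ∀ z ∈ disc I, dbar f I z = 0

/-- The quaternion `i`. -/
def unitI : ℍ[ℝ] := ⟨0, 1, 0, 0⟩

open Classical in
/-- An imaginary unit `I` with `q = Re q + |Im q| I`; the unit `i` if `q` is real. -/
def unitOf (q : ℍ[ℝ]) : ℍ[ℝ] :=
  if q.im = 0 then unitI else ‖q.im‖⁻¹ • q.im

/-- The slice derivative `f'`: it is `∂_I f` on the plane `ℝ + ℝ I`. By `sliceDeriv_eq_dI`,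
for a slice regular function the choice of `I` does not matter. -/
def sliceDeriv (f : ℍ[ℝ] → ℍ[ℝ]) (q : ℍ[ℝ]) : ℍ[ℝ] :=
  dI f (unitOf q) (q.re, ‖q.im‖)

/-- Slice starlike functions on the open unit ball. At `q = 0` the quotient
`f(q)⁻¹ q f'(q)` is of the form `0⁻¹ * 0`, so the positivity is required where it makes sense,
at the points `q ≠ 0` of the ball. -/
structure IsSliceStarlike (f : ℍ[ℝ] → ℍ[ℝ]) : Prop where
  sliceRegular : IsSliceRegular f
  sliceDeriv_zero : sliceDeriv f 0 = 1
  zero_iff : ∀ q : ℍ[ℝ], ‖q‖ < 1 → (f q = 0 ↔ q = 0)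
  re_pos : ∀ q : ℍ[ℝ], ‖q‖ < 1 → q ≠ 0 → 0 < ((f q)⁻¹ * q * sliceDeriv f q).re

/-- The value at `q` of the power series `∑ q ^ k a_k` with coefficients on the right. The
regular product of two such series is the product in the ring `PowerSeries ℍ[ℝ]`, with
coefficients `∑ a_n b_(k-n)`. -/
def eval (a : PowerSeries ℍ[ℝ]) (q : ℍ[ℝ]) : ℍ[ℝ] :=
  ∑' k : ℕ, q ^ k * PowerSeries.coeff k a

/-- The regular conjugate `f^c`. -/
def regularConj (a : PowerSeries ℍ[ℝ]) : PowerSeries ℍ[ℝ] :=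
  PowerSeries.mk fun k => star (PowerSeries.coeff k a)

/-- The symmetrization `f^s = f * f^c`. -/
def symmetrization (a : PowerSeries ℍ[ℝ]) : PowerSeries ℍ[ℝ] := a * regularConj a

/-- The regular reciprocal `f^{-*}(q) = f^s(q)⁻¹ f^c(q)`. -/
def regularRecip (a : PowerSeries ℍ[ℝ]) (q : ℍ[ℝ]) : ℍ[ℝ] :=
  (eval (symmetrization a) q)⁻¹ * eval (regularConj a) q

/-- The quaternionic Koebe function `q (1 - q u)^{-*2}`, where `(1 - q u)^{-*2}` is the regular
reciprocal of the regular square of `1 - q u`. -/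
def koebe (u : ℍ[ℝ]) (q : ℍ[ℝ]) : ℍ[ℝ] :=
  q * regularRecip ((1 - PowerSeries.X * PowerSeries.C u) ^ 2) q

theorem dI_neg (f : ℍ[ℝ] → ℍ[ℝ]) (I : ℍ[ℝ]) (x y : ℝ) : dI f (-I) (x, -y) = dI f I (x, y) := by
  let e : (ℝ × ℝ) ≃L[ℝ] (ℝ × ℝ) :=
    (ContinuousLinearEquiv.refl ℝ ℝ).prodCongr (ContinuousLinearEquiv.neg ℝ)
  have he : restrict f (-I) = restrict f I ∘ e := by
    funext z; simp [restrict, e]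
  have hf : fderiv ℝ (restrict f (-I)) (x, -y) = (fderiv ℝ (restrict f I) (x, y)).comp
      (e : (ℝ × ℝ) →L[ℝ] (ℝ × ℝ)) := by
    rw [he, e.comp_right_fderiv]; simp [e]
  have h2 : fderiv ℝ (restrict f I) (x, y) (0, -1) = -fderiv ℝ (restrict f I) (x, y) (0, 1) := by
    rw [← map_neg]; simp
  simp [dI, partialX, partialY, hf, e, h2]

theorem dI_eq_partialX {f : ℍ[ℝ] → ℍ[ℝ]} {I : ℍ[ℝ]} {z : ℝ × ℝ} (h : dbar f I z = 0) :
    dI f I z = partialX f I z := by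
  have h' : partialX f I z + I * partialY f I z = 0 := by
    rw [dbar] at h
    exact (smul_eq_zero.mp h).resolve_left (by norm_num)
  have h2 : I * partialY f I z = -partialX f I z := by
    rw [eq_neg_iff_add_eq_zero, add_comm]; exact h'
  rw [dI, h2, sub_neg_eq_add, ← two_smul ℝ, smul_smul]; norm_num

theorem partialX_real {f : ℍ[ℝ] → ℍ[ℝ]} {I : ℍ[ℝ]} {x : ℝ}
    (h : DifferentiableAt ℝ (restrict f I) (x, 0)) :
    partialX f I (x, 0) = deriv (fun t : ℝ => f (t : ℍ[ℝ])) x := by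
  have h1 : HasDerivAt (fun t : ℝ => (t, (0 : ℝ))) ((1 : ℝ), (0 : ℝ)) x :=
    (hasDerivAt_id x).prodMk (hasDerivAt_const x 0)
  have h2 := h.hasFDerivAt.comp_hasDerivAt x h1
  have h3 : restrict f I ∘ (fun t : ℝ => (t, (0 : ℝ))) = fun t : ℝ => f (t : ℍ[ℝ]) := by
    funext t; simp [restrict]
  rw [h3] at h2
  exact h2.deriv.symm

theorem unit_re_norm {I : ℍ[ℝ]} (hI : I ∈ imaginaryUnits) : I.re = 0 ∧ ‖I‖ = 1 := by
  have h : I * I = -1 := hI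
  have hn : ‖I‖ = 1 := by
    have h1 : ‖I‖ * ‖I‖ = 1 := by rw [← norm_mul, h]; simp
    nlinarith [norm_nonneg I]
  refine ⟨?_, hn⟩
  have h0 := congrArg (fun q : ℍ[ℝ] => q.re) h
  have hs : ‖I‖ * ‖I‖ = I.re ^ 2 + I.imI ^ 2 + I.imJ ^ 2 + I.imK ^ 2 := by
    rw [← Quaternion.normSq_eq_norm_mul_self, Quaternion.normSq_def']
  simp at h0
  rw [hn] at hs
  nlinarith

/-- The slice derivative of a slice regular function agrees with `∂_I f` on every plane. -/
theorem sliceDeriv_eq_dI {f : ℍ[ℝ] → ℍ[ℝ]} (hf : IsSliceRegular f) {I : ℍ[ℝ]}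
    (hI : I ∈ imaginaryUnits) {x y : ℝ} (hz : (x, y) ∈ disc I) :
    sliceDeriv f ((x : ℍ[ℝ]) + y • I) = dI f I (x, y) := by
  obtain ⟨hre, hn⟩ := unit_re_norm hI
  have him : ((x : ℍ[ℝ]) + y • I).im = y • I := by
    ext <;> simp [hre]
  have hr : ((x : ℍ[ℝ]) + y • I).re = x := by simp [hre]
  rcases eq_or_ne y 0 with rfl | hy
  · have hi : unitI ∈ imaginaryUnits := by
      change unitI * unitI = -1
      have h0 : unitI.re = 0 := rfl
      have h1 : unitI.imI = 1 := rfl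
      have h2 : unitI.imJ = 0 := rfl
      have h3 : unitI.imK = 0 := rfl
      ext <;> simp [h0, h1, h2, h3]
    have hd : ∀ J : ℍ[ℝ], J ∈ imaginaryUnits → dI f J (x, 0) =
        deriv (fun t : ℝ => f (t : ℍ[ℝ])) x := by
      intro J hJ
      have hzJ : (x, (0 : ℝ)) ∈ disc J := by simpa [disc] using hz
      have ho : IsOpen (disc J) := by
        have hc : Continuous fun z : ℝ × ℝ => ‖(z.1 : ℍ[ℝ]) + z.2 • J‖ := by
          have := Quaternion.continuous_coe
          fun_prop
        exact isOpen_lt hc continuous_const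
      rw [dI_eq_partialX ((hf J hJ).2 _ hzJ)]
      exact partialX_real (((hf J hJ).1.contDiffAt (ho.mem_nhds hzJ)).differentiableAt (by simp))
    rw [hd I hI]
    simpa [sliceDeriv, unitOf, him, hr] using hd _ hi
  · have hI0 : I ≠ 0 := by rintro rfl; simp at hn
    have hne : y • I ≠ 0 := smul_ne_zero hy hI0
    rw [sliceDeriv, unitOf, him, hr, if_neg hne, norm_smul, hn, mul_one, Real.norm_eq_abs,
      smul_smul]
    rcases lt_or_gt_of_ne hy with h | h
    · rw [abs_of_neg h]
      have : (-y)⁻¹ * y = -1 := by field_simp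
      rw [this, neg_one_smul, dI_neg]
    · rw [abs_of_pos h, inv_mul_cancel₀ hy, one_smul]

end SliceStarlike

end

noncomputable section

namespace SliceStarlike

open Finset Metric

/-! Replacing the central unit of `ℍ[ℂ]` by an imaginary unit `I` turns a holomorphic stem function
on the complex disc, with values in `ℍ[ℂ]`, into a slice regular function. Pointwise products of
stem functions then correspond to regular products, and Taylor coefficients multiply by the Cauchy
product.

The sharp bound is `‖p k‖ ≤ k`. Write `f(q) = q g(q)`, so that the starlike quotient `f⁻¹ q f'` is
the pointwise quotient `g⁻¹ f'`. Let `A`, `D` be the stem functions of `g`, `f'` and `B = A⁻¹ D`.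
The values of `B` are the pointwise quotients at conjugated units, and these conjugations are onto
(`evalAt_re_pos_of_mul`). Hence `B` has positive real part and `B 0 = 1`, and its coefficients
satisfy `‖c n‖ ≤ 2` for `n ≠ 0` by Carathéodory's inequality, applied in the plane that contains `c
n` (`norm_coeff_le_two`). Comparing coefficients in `A B = D` gives a recursion from which the bound
follows by induction (`norm_le_of_convolution`).

The majorant `∑ k r ^ k = r / (1 - r) ^ 2` is at most `1` exactly up to the smaller root `(3 - √5) /
2` of `r ^ 2 - 3 r + 1`. The Koebe functions attain every coefficient bound; they are starlike
because their functional equation, once differentiated, shows that `w = f⁻¹ q f'` satisfies `‖w - 1‖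
< ‖w + 1‖`. -/

/-! ### Complexified quaternions and their values at imaginary units -/

/-- The real part of a complexified quaternion. -/
def reQ (w : ℍ[ℂ]) : ℍ[ℝ] := ⟨w.re.re, w.imI.re, w.imJ.re, w.imK.re⟩

/-- The imaginary part of a complexified quaternion. -/
def imQ (w : ℍ[ℂ]) : ℍ[ℝ] := ⟨w.re.im, w.imI.im, w.imJ.im, w.imK.im⟩

@[simp] theorem reQ_re (w : ℍ[ℂ]) : (reQ w).re = w.re.re := rfl
@[simp] theorem reQ_imI (w : ℍ[ℂ]) : (reQ w).imI = w.imI.re := rfl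
@[simp] theorem reQ_imJ (w : ℍ[ℂ]) : (reQ w).imJ = w.imJ.re := rfl
@[simp] theorem reQ_imK (w : ℍ[ℂ]) : (reQ w).imK = w.imK.re := rfl
@[simp] theorem imQ_re (w : ℍ[ℂ]) : (imQ w).re = w.re.im := rfl
@[simp] theorem imQ_imI (w : ℍ[ℂ]) : (imQ w).imI = w.imI.im := rfl
@[simp] theorem imQ_imJ (w : ℍ[ℂ]) : (imQ w).imJ = w.imJ.im := rfl
@[simp] theorem imQ_imK (w : ℍ[ℂ]) : (imQ w).imK = w.imK.im := rfl

/-- Evaluation of a complexified quaternion at an imaginary unit `I`, replacing the central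
complex unit by left multiplication by `I`. -/
def evalAt (I : ℍ[ℝ]) (w : ℍ[ℂ]) : ℍ[ℝ] := reQ w + I * imQ w

/-- The canonical embedding of the quaternions into their complexification. -/
def complexifyFun (a : ℍ[ℝ]) : ℍ[ℂ] := ⟨a.re, a.imI, a.imJ, a.imK⟩

@[simp] theorem complexifyFun_re (a : ℍ[ℝ]) : (complexifyFun a).re = a.re := rfl
@[simp] theorem complexifyFun_imI (a : ℍ[ℝ]) : (complexifyFun a).imI = a.imI := rfl
@[simp] theorem complexifyFun_imJ (a : ℍ[ℝ]) : (complexifyFun a).imJ = a.imJ := rfl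
@[simp] theorem complexifyFun_imK (a : ℍ[ℝ]) : (complexifyFun a).imK = a.imK := rfl

/-- The canonical embedding of the quaternions into their complexification, as a ring
homomorphism. -/
def complexify : ℍ[ℝ] →+* ℍ[ℂ] where
  toFun := complexifyFun
  map_one' := by ext <;> simp
  map_zero' := by ext <;> simp
  map_mul' a b := by ext <;> simp
  map_add' a b := by ext <;> simp

@[simp] theorem complexify_re (a : ℍ[ℝ]) : (complexify a).re = a.re := rfl
@[simp] theorem complexify_imI (a : ℍ[ℝ]) : (complexify a).imI = a.imI := rfl
@[simp] theorem complexify_imJ (a : ℍ[ℝ]) : (complexify a).imJ = a.imJ := rfl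
@[simp] theorem complexify_imK (a : ℍ[ℝ]) : (complexify a).imK = a.imK := rfl

/-- The component of a complexified quaternion along the plane `ℝ + ℝ I`. -/
def planePart (I : ℍ[ℝ]) (w : ℍ[ℂ]) : ℂ :=
  w.re + Complex.I * (I.imI * w.imI + I.imJ * w.imJ + I.imK * w.imK)

theorem complexify_injective : Function.Injective complexify := by
  intro a b h
  ext
  · simpa [complexify] using congrArg (fun w : ℍ[ℂ] => w.re.re) h
  · simpa [complexify] using congrArg (fun w : ℍ[ℂ] => w.imI.re) h
  · simpa [complexify] using congrArg (fun w : ℍ[ℂ] => w.imJ.re) h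
  · simpa [complexify] using congrArg (fun w : ℍ[ℂ] => w.imK.re) h

theorem reQ_mul (A B : ℍ[ℂ]) : reQ (A * B) = reQ A * reQ B - imQ A * imQ B := by
  ext <;> simp <;> ring

theorem imQ_mul (A B : ℍ[ℂ]) : imQ (A * B) = reQ A * imQ B + imQ A * reQ B := by
  ext <;> simp <;> ring

/-- The component orthogonal to the plane of `I` does not affect the real part, so positivity passes
to a single complex-valued function. -/
theorem planePart_re {I : ℍ[ℝ]} (hI : I ∈ imaginaryUnits) (w : ℍ[ℂ]) :
    (planePart I w).re = (evalAt I w).re := by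
  have h0 := (unit_re_norm hI).1
  simp [planePart, evalAt, h0]
  ring

theorem unitOf_mem (q : ℍ[ℝ]) : unitOf q ∈ imaginaryUnits := by
  change unitOf q * unitOf q = -1
  rw [unitOf]
  split_ifs with h
  · have h0 : unitI.re = 0 := rfl
    have h1 : unitI.imI = 1 := rfl
    have h2 : unitI.imJ = 0 := rfl
    have h3 : unitI.imK = 0 := rfl
    ext <;> simp [h0, h1, h2, h3]
  · have hn : ‖q.im‖ ≠ 0 := norm_ne_zero_iff.mpr h
    rw [smul_mul_smul_comm, ← sq q.im, Quaternion.im_sq, Quaternion.normSq_eq_norm_mul_self]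
    ext <;> simp
    field_simp

theorem re_add_norm_im_smul_unitOf (q : ℍ[ℝ]) : (q.re : ℍ[ℝ]) + ‖q.im‖ • unitOf q = q := by
  rw [unitOf]
  split_ifs with h
  · have := q.re_add_im
    rw [h, add_zero] at this
    rw [h, norm_zero, zero_smul, add_zero, this]
  · have hn : ‖q.im‖ ≠ 0 := norm_ne_zero_iff.mpr h
    rw [smul_smul, mul_inv_cancel₀ hn, one_smul, q.re_add_im]

theorem sum_sq_unit {I : ℍ[ℝ]} (hI : I ∈ imaginaryUnits) :
    I.imI ^ 2 + I.imJ ^ 2 + I.imK ^ 2 = 1 := by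
  obtain ⟨h0, h1⟩ := unit_re_norm hI
  have hs : ‖I‖ * ‖I‖ = I.re ^ 2 + I.imI ^ 2 + I.imJ ^ 2 + I.imK ^ 2 := by
    rw [← Quaternion.normSq_eq_norm_mul_self, Quaternion.normSq_def']
  rw [h1, h0] at hs
  linarith

theorem norm_add_smul_unit {I : ℍ[ℝ]} (hI : I ∈ imaginaryUnits) (x y : ℝ) :
    ‖(x : ℍ[ℝ]) + y • I‖ = ‖(⟨x, y⟩ : ℂ)‖ := by
  have h0 := (unit_re_norm hI).1
  rw [← sq_eq_sq₀ (norm_nonneg _) (norm_nonneg _), Complex.sq_norm, Complex.normSq_mk, sq,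
    ← Quaternion.normSq_eq_norm_mul_self, Quaternion.normSq_def']
  simp [h0]
  linear_combination y ^ 2 * sum_sq_unit hI

/-- If `I` is chosen so that `c` lies in `ℝ + ℝ I`, projecting to that plane loses nothing. -/
theorem exists_norm_planePart (c : ℍ[ℝ]) :
    ∃ I ∈ imaginaryUnits, ‖planePart I (complexify c)‖ = ‖c‖ := by
  have hI := unitOf_mem c
  refine ⟨unitOf c, hI, ?_⟩
  have hc := re_add_norm_im_smul_unitOf c
  set I := unitOf c
  have h0 := (unit_re_norm hI).1
  have key : planePart I (complexify c) = ⟨c.re, ‖c.im‖⟩ := by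
    have hi := congrArg (fun q : ℍ[ℝ] => q.imI) hc
    have hj := congrArg (fun q : ℍ[ℝ] => q.imJ) hc
    have hk := congrArg (fun q : ℍ[ℝ] => q.imK) hc
    simp at hi hj hk
    apply Complex.ext
    · simp [planePart]
    · simp [planePart, ← hi, ← hj, ← hk]
      linear_combination ‖c.im‖ * sum_sq_unit hI
  rw [key, ← norm_add_smul_unit hI, hc]

theorem evalAt_mul' {I : ℍ[ℝ]} (hI : I ∈ imaginaryUnits) (A B : ℍ[ℂ]) :
    evalAt I (A * B) = evalAt I A * reQ B + I * (evalAt I A * imQ B) := by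
  have hI' : I * I = -1 := hI
  have h : I * (I * (imQ A * imQ B)) = -(imQ A * imQ B) := by rw [← mul_assoc, hI', neg_one_mul]
  simp only [evalAt, reQ_mul, imQ_mul, mul_add, add_mul, mul_assoc, h]
  abel

theorem conj_mem_imaginaryUnits {I a : ℍ[ℝ]} (hI : I ∈ imaginaryUnits) (ha : a ≠ 0) :
    a⁻¹ * I * a ∈ imaginaryUnits := by
  have hI' : I * I = -1 := hI
  change a⁻¹ * I * a * (a⁻¹ * I * a) = -1
  calc a⁻¹ * I * a * (a⁻¹ * I * a) = a⁻¹ * I * (a * a⁻¹) * I * a := by simp only [mul_assoc]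
    _ = a⁻¹ * (I * I) * a := by rw [mul_inv_cancel₀ ha]; simp only [mul_assoc, one_mul]
    _ = -1 := by rw [hI']; simp [ha]

/-- With `a = evalAt I A`, the unit `I` moves past `a` through `I a = a (a⁻¹ I a)`. This is the
pointwise formula for the regular product. -/
theorem evalAt_mul {I : ℍ[ℝ]} (hI : I ∈ imaginaryUnits) {A : ℍ[ℂ]} (hA : evalAt I A ≠ 0)
    (B : ℍ[ℂ]) :
    evalAt I (A * B) = evalAt I A * evalAt ((evalAt I A)⁻¹ * I * evalAt I A) B := by
  rw [evalAt_mul' hI]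
  set a := evalAt I A
  rw [evalAt, mul_add]
  simp only [mul_assoc, mul_inv_cancel_left₀ hA]

theorem evalAt_mul_eq_zero {I : ℍ[ℝ]} (hI : I ∈ imaginaryUnits) {A : ℍ[ℂ]}
    (hA : evalAt I A = 0) (B : ℍ[ℂ]) : evalAt I (A * B) = 0 := by
  simp [evalAt_mul' hI, hA]

/-- A complex scalar evaluates into `ℝ + ℝ I`, which commutes with `I`; no conjugation appears. -/
theorem evalAt_coe_mul {I : ℍ[ℝ]} (hI : I ∈ imaginaryUnits) (c : ℂ) (B : ℍ[ℂ]) :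
    evalAt I ((c : ℍ[ℂ]) * B) = evalAt I c * evalAt I B := by
  have h1 : imQ (c : ℍ[ℂ]) = (c.im : ℍ[ℝ]) := by ext <;> simp
  have h2 : reQ (c : ℍ[ℂ]) = (c.re : ℍ[ℝ]) := by ext <;> simp
  have h3 : I * evalAt I c = evalAt I c * I := by
    rw [evalAt, h1, h2, mul_add, add_mul, Quaternion.mul_coe_eq_smul, Quaternion.mul_coe_eq_smul,
      Quaternion.coe_mul_eq_smul, mul_smul_comm, smul_mul_assoc]
  rw [evalAt_mul' hI, ← mul_assoc, h3, mul_assoc, ← mul_add, evalAt, evalAt]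

theorem evalAt_coe {I : ℍ[ℝ]} (c : ℂ) : evalAt I (c : ℍ[ℂ]) = (c.re : ℍ[ℝ]) + c.im • I := by
  have h1 : imQ (c : ℍ[ℂ]) = (c.im : ℍ[ℝ]) := by ext <;> simp
  have h2 : reQ (c : ℍ[ℂ]) = (c.re : ℍ[ℝ]) := by ext <;> simp
  rw [evalAt, h1, h2, Quaternion.mul_coe_eq_smul]

theorem evalAt_coe_ne_zero {I : ℍ[ℝ]} (hI : I ∈ imaginaryUnits) {c : ℂ} (hc : c ≠ 0) :
    evalAt I (c : ℍ[ℂ]) ≠ 0 := by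
  rw [evalAt_coe, ← norm_ne_zero_iff, norm_add_smul_unit hI]
  simpa using hc

/-- A complexified quaternion with no zero on the sphere of imaginary units is invertible. -/
theorem normSq_ne_zero_of_evalAt {A : ℍ[ℂ]} (h : ∀ I ∈ imaginaryUnits, evalAt I A ≠ 0) :
    Quaternion.normSq A ≠ 0 := by
  intro hN
  rw [Quaternion.normSq_def'] at hN
  have hre := congrArg Complex.re hN
  have him := congrArg Complex.im hN
  simp [pow_two] at hre him
  set a := reQ A with ha
  set b := imQ A with hb
  have h1 : Quaternion.normSq a = Quaternion.normSq b := by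
    rw [Quaternion.normSq_def', Quaternion.normSq_def']
    simp [ha, hb]
    linarith
  have h2 : (a * star b).re = 0 := by
    simp [ha, hb]
    linarith
  by_cases hb0 : b = 0
  · have ha0 : a = 0 := by
      rw [hb0, map_zero] at h1
      exact Quaternion.normSq_eq_zero.mp h1
    exact h _ (unitOf_mem 0) (by rw [evalAt, ← ha, ← hb, ha0, hb0]; simp)
  · have hnb : Quaternion.normSq b ≠ 0 := Quaternion.normSq_ne_zero.mpr hb0
    have hre0 : (a * b⁻¹).re = 0 := by
      rw [Quaternion.inv_def, mul_smul_comm, Quaternion.re_smul, h2, smul_zero]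
    have hn : Quaternion.normSq (a * b⁻¹) = 1 := by
      rw [map_mul, Quaternion.normSq_inv, h1, mul_inv_cancel₀ hnb]
    -- Solving `a + I b = 0` forces this unit. It squares to `-1` because `normSq A = 0` says that
    -- `a` and `b` are orthogonal and of equal norm.
    refine h (-(a * b⁻¹)) ?_ ?_
    · change -(a * b⁻¹) * -(a * b⁻¹) = -1
      rw [neg_mul_neg, ← sq, Quaternion.sq_eq_neg_normSq.mpr hre0, hn]
      simp
    · rw [evalAt, ← ha, ← hb, neg_mul, mul_assoc, inv_mul_cancel₀ hb0]
      simp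

/-- If every value of `A * B` at a unit, divided by the value of `A`, has positive real part, so
has every value of `B`: the conjugations relating the two are onto the sphere of units. -/
theorem evalAt_re_pos_of_mul {A B C : ℍ[ℂ]} (hC : A * B = C) (hA : Quaternion.normSq A ≠ 0)
    (h : ∀ I ∈ imaginaryUnits, 0 < ((evalAt I A)⁻¹ * evalAt I C).re) {I : ℍ[ℝ]}
    (hI : I ∈ imaginaryUnits) : 0 < (evalAt I B).re := by
  set N := Quaternion.normSq A
  have hN : evalAt I (N : ℍ[ℂ]) ≠ 0 := evalAt_coe_ne_zero hI hA
  have h1 : star A * A = N := Quaternion.star_mul_self A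
  have hs : evalAt I (star A) ≠ 0 := fun h0 => hN (by rw [← h1, evalAt_mul_eq_zero hI h0])
  -- Conjugating by the value of `star A` inverts the conjugation by the value of `A`: evaluating
  -- `star A * A = N` and `star A * C = N * B` at `I` brings in `A` and `C` at `J`, next to `B` at
  -- `I`.
  set J := (evalAt I (star A))⁻¹ * I * evalAt I (star A)
  have hJ : J ∈ imaginaryUnits := conj_mem_imaginaryUnits hI hs
  have h2 : evalAt I (star A) * evalAt J A = evalAt I N := by rw [← evalAt_mul hI hs, h1]
  have h3 : evalAt I (star A) * evalAt J C = evalAt I N * evalAt I B := by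
    rw [← evalAt_mul hI hs, ← evalAt_coe_mul hI, ← h1, mul_assoc, hC]
  have hJA : evalAt J A ≠ 0 := by
    intro h0; rw [h0, mul_zero] at h2; exact hN h2.symm
  have h4 : evalAt I B = (evalAt J A)⁻¹ * evalAt J C := by
    rw [← h2, mul_assoc] at h3
    rw [mul_left_cancel₀ hs h3, inv_mul_cancel_left₀ hJA]
  rw [h4]
  exact h J hJ

/-! ### Taylor coefficients and complex power series -/

/-- The Taylor coefficients at the origin of a function on the complex plane. -/
def taylorCoeff (n : ℕ) (f : ℂ → ℂ) : ℂ := iteratedDeriv n f 0 / (n.factorial : ℂ)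

theorem analyticAt_zero {f : ℂ → ℂ} (hf : DifferentiableOn ℂ f (ball 0 1)) : AnalyticAt ℂ f 0 :=
  hf.analyticAt (ball_mem_nhds 0 one_pos)

theorem taylorCoeff_zero (f : ℂ → ℂ) : taylorCoeff 0 f = f 0 := by simp [taylorCoeff]

theorem taylorCoeff_mul {f g : ℂ → ℂ} (hf : DifferentiableOn ℂ f (ball 0 1))
    (hg : DifferentiableOn ℂ g (ball 0 1)) (n : ℕ) :
    taylorCoeff n (fun z => f z * g z) =
      ∑ i ∈ range (n + 1), taylorCoeff i f * taylorCoeff (n - i) g := by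
  have h := iteratedDeriv_mul (n := n) (analyticAt_zero hf).contDiffAt
    (analyticAt_zero hg).contDiffAt
  rw [taylorCoeff]
  change iteratedDeriv n (f * g) 0 / _ = _
  rw [h, sum_div]
  refine sum_congr rfl fun i hi => ?_
  have hi' : i ≤ n := by simpa [Nat.lt_succ_iff] using hi
  have hc := Nat.choose_mul_factorial_mul_factorial hi'
  have hc' : ((n.choose i : ℕ) : ℂ) * i.factorial * (n - i).factorial = n.factorial := by
    exact_mod_cast hc
  have h1 : (i.factorial : ℂ) ≠ 0 := by exact_mod_cast i.factorial_ne_zero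
  have h2 : ((n - i).factorial : ℂ) ≠ 0 := by exact_mod_cast (n - i).factorial_ne_zero
  have h3 : (n.factorial : ℂ) ≠ 0 := by exact_mod_cast n.factorial_ne_zero
  rw [taylorCoeff, taylorCoeff]
  field_simp
  rw [← hc']
  ring

theorem taylorCoeff_add {f g : ℂ → ℂ} (hf : DifferentiableOn ℂ f (ball 0 1))
    (hg : DifferentiableOn ℂ g (ball 0 1)) (n : ℕ) :
    taylorCoeff n (fun z => f z + g z) = taylorCoeff n f + taylorCoeff n g := by
  have h := iteratedDeriv_add (n := n) (analyticAt_zero hf).contDiffAt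
    (analyticAt_zero hg).contDiffAt
  rw [taylorCoeff]
  change iteratedDeriv n (f + g) 0 / _ = _
  rw [h, add_div]; rfl

theorem taylorCoeff_const_mul (f : ℂ → ℂ) (c : ℂ) (n : ℕ) :
    taylorCoeff n (fun z => c * f z) = c * taylorCoeff n f := by
  rw [taylorCoeff, iteratedDeriv_const_mul_field, taylorCoeff, mul_div_assoc]

theorem taylorCoeff_sub {f g : ℂ → ℂ} (hf : DifferentiableOn ℂ f (ball 0 1))
    (hg : DifferentiableOn ℂ g (ball 0 1)) (n : ℕ) :
    taylorCoeff n (fun z => f z - g z) = taylorCoeff n f - taylorCoeff n g := by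
  have h := iteratedDeriv_sub (n := n) (analyticAt_zero hf).contDiffAt
    (analyticAt_zero hg).contDiffAt
  rw [taylorCoeff]
  change iteratedDeriv n (f - g) 0 / _ = _
  rw [h, sub_div]; rfl

theorem taylorCoeff_deriv (f : ℂ → ℂ) (n : ℕ) :
    taylorCoeff n (deriv f) = (n + 1) * taylorCoeff (n + 1) f := by
  rw [taylorCoeff, taylorCoeff, iteratedDeriv_succ', Nat.factorial_succ]
  have h3 : (n.factorial : ℂ) ≠ 0 := by exact_mod_cast n.factorial_ne_zero
  have h4 : (n : ℂ) + 1 ≠ 0 := by exact_mod_cast n.succ_ne_zero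
  push_cast
  field_simp

theorem taylorCoeff_congr {f g : ℂ → ℂ} (h : Set.EqOn f g (ball 0 1)) (n : ℕ) :
    taylorCoeff n f = taylorCoeff n g := by
  have : f =ᶠ[nhds 0] g := h.eventuallyEq_of_mem (ball_mem_nhds 0 one_pos)
  rw [taylorCoeff, this.iteratedDeriv_eq, taylorCoeff]

/-- A power series with coefficients of radius of convergence at least one. -/
def SummableOnDisc (a : ℕ → ℂ) : Prop := ∀ r : ℝ, 0 ≤ r → r < 1 → Summable fun k => ‖a k‖ * r ^ k

/-- The sum of a complex power series. -/
def powerSum (a : ℕ → ℂ) (z : ℂ) : ℂ := ∑' k, a k * z ^ k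

theorem SummableOnDisc.summable {a : ℕ → ℂ} (ha : SummableOnDisc a) {z : ℂ} (hz : ‖z‖ < 1) :
    Summable fun k => a k * z ^ k := by
  refine Summable.of_norm ?_
  simpa using ha ‖z‖ (norm_nonneg z) hz

theorem SummableOnDisc.hasFPowerSeriesOnBall {a : ℕ → ℂ} (ha : SummableOnDisc a) :
    HasFPowerSeriesOnBall (powerSum a) (FormalMultilinearSeries.ofScalars ℂ a) 0 1 := by
  set p := FormalMultilinearSeries.ofScalars ℂ a with hp
  have hr : 1 ≤ p.radius := by
    refine ENNReal.le_of_forall_nnreal_lt fun r hr => ?_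
    have hr' : (r : ℝ) < 1 := by exact_mod_cast hr
    refine p.le_radius_of_summable_norm ?_
    refine (ha r r.2 hr').congr fun k => ?_
    rw [hp, FormalMultilinearSeries.ofScalars_norm]
  have h1 := (p.hasFPowerSeriesOnBall (one_pos.trans_le hr)).mono one_pos hr
  have h2 : p.sum = powerSum a := by
    have := FormalMultilinearSeries.ofScalarsSum_eq_tsum (E := ℂ) a
    funext z
    change FormalMultilinearSeries.ofScalarsSum a z = _
    rw [this]
    simp [powerSum]
  rwa [h2] at h1

theorem SummableOnDisc.differentiableOn {a : ℕ → ℂ} (ha : SummableOnDisc a) :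
    DifferentiableOn ℂ (powerSum a) (ball 0 1) := by
  have := ha.hasFPowerSeriesOnBall.differentiableOn
  refine this.mono fun z hz => ?_
  rw [Metric.mem_eball, edist_dist, ENNReal.ofReal_lt_one]
  exact hz

theorem SummableOnDisc.taylorCoeff_powerSum {a : ℕ → ℂ} (ha : SummableOnDisc a) (n : ℕ) :
    taylorCoeff n (powerSum a) = a n := by
  have h1 := ha.hasFPowerSeriesOnBall.hasFPowerSeriesAt
  have h2 := h1.analyticAt.hasFPowerSeriesAt
  have h3 := h2.eq_formalMultilinearSeries h1
  exact congrFun (FormalMultilinearSeries.ofScalars_series_injective ℂ ℂ h3) n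

/-! ### Integrals over circles and Carathéodory's inequality -/

theorem continuous_comp_circleMap {G : ℂ → ℂ} (hG : DifferentiableOn ℂ G (ball 0 1)) {r : ℝ}
    (hr0 : 0 < r) (hr1 : r < 1) : Continuous fun θ : ℝ => G (circleMap 0 r θ) := by
  refine hG.continuousOn.comp_continuous (continuous_circleMap 0 r) fun θ => ?_
  simpa [abs_of_pos hr0] using hr1

theorem integral_circleMap_pow_inv_mul {G : ℂ → ℂ} (hG : DifferentiableOn ℂ G (ball 0 1)) {r : ℝ}
    (hr0 : 0 < r) (hr1 : r < 1) (n : ℕ) :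
    ∫ θ in (0 : ℝ)..2 * Real.pi, (circleMap 0 r θ ^ n)⁻¹ * G (circleMap 0 r θ) =
      2 * Real.pi * taylorCoeff n G := by
  have h := (hG.mono (closedBall_subset_ball hr1)).circleIntegral_one_div_sub_center_pow_smul hr0 n
  have h1 : (∮ z in C(0, r), (1 / (z - 0) ^ (n + 1)) • G z) =
      Complex.I * ∫ θ in (0 : ℝ)..2 * Real.pi, (circleMap 0 r θ ^ n)⁻¹ * G (circleMap 0 r θ) := by
    rw [circleIntegral, ← intervalIntegral.integral_const_mul]
    refine intervalIntegral.integral_congr fun θ _ => ?_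
    have hw : circleMap 0 r θ ≠ 0 := circleMap_ne_center hr0.ne'
    simp only [deriv_circleMap, smul_eq_mul, sub_zero, pow_succ]
    field_simp
  rw [h1] at h
  apply mul_left_cancel₀ Complex.I_ne_zero
  rw [h, taylorCoeff, smul_eq_mul]
  ring

theorem integral_circleMap_pow_mul {G : ℂ → ℂ} (hG : DifferentiableOn ℂ G (ball 0 1)) {r : ℝ}
    (hr0 : 0 < r) (hr1 : r < 1) (n : ℕ) :
    ∫ θ in (0 : ℝ)..2 * Real.pi, circleMap 0 r θ ^ (n + 1) * G (circleMap 0 r θ) = 0 := by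
  have hd : DifferentiableOn ℂ (fun z => z ^ n * G z) (ball 0 1) :=
    (differentiableOn_id.pow n).mul hG
  have h := (hd.diffContOnCl_ball (closedBall_subset_ball hr1)).circleIntegral_eq_zero hr0.le
  rw [circleIntegral] at h
  apply mul_left_cancel₀ Complex.I_ne_zero
  rw [mul_zero, ← intervalIntegral.integral_const_mul]
  refine Eq.trans ?_ h
  refine intervalIntegral.integral_congr fun θ _ => ?_
  simp only [deriv_circleMap, smul_eq_mul]
  ring

/-- Carathéodory's bound for the coefficients of a function with nonnegative real part. -/
theorem norm_taylorCoeff_le_of_re_nonneg {G : ℂ → ℂ} (hG : DifferentiableOn ℂ G (ball 0 1))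
    (hre : ∀ z ∈ ball (0 : ℂ) 1, 0 ≤ (G z).re) {n : ℕ} (hn : n ≠ 0) :
    ‖taylorCoeff n G‖ ≤ 2 * (G 0).re := by
  have key : ∀ r ∈ Set.Ioo (0 : ℝ) 1, ‖taylorCoeff n G‖ * r ^ n ≤ 2 * (G 0).re := by
    rintro r ⟨hr0, hr1⟩
    have hGc := continuous_comp_circleMap hG hr0 hr1
    have hw0 : ∀ θ, circleMap 0 r θ ≠ 0 := fun θ => circleMap_ne_center hr0.ne'
    have hwc : Continuous fun θ => (circleMap 0 r θ ^ n)⁻¹ :=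
      ((continuous_circleMap 0 r).pow n).inv₀ fun θ => pow_ne_zero n (hw0 θ)
    have h1 := integral_circleMap_pow_inv_mul hG hr0 hr1 n
    -- On the circle `z⁻ⁿ = r⁻²ⁿ conj(zⁿ)`, so this is a multiple of the conjugate of an integral
    -- that vanishes by Cauchy's theorem.
    have h2 : ∫ θ in (0 : ℝ)..2 * Real.pi,
        (circleMap 0 r θ ^ n)⁻¹ * (starRingEnd ℂ) (G (circleMap 0 r θ)) = 0 := by
      obtain ⟨m, rfl⟩ := Nat.exists_eq_succ_of_ne_zero hn
      have h3 := congrArg (starRingEnd ℂ) (integral_circleMap_pow_mul hG hr0 hr1 m)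
      rw [← intervalIntegral.intervalIntegral_conj, map_zero] at h3
      have h4 : ∀ θ : ℝ, (circleMap 0 r θ ^ (m + 1))⁻¹ * (starRingEnd ℂ) (G (circleMap 0 r θ)) =
          ((r : ℂ) ^ (2 * (m + 1)))⁻¹ *
            (starRingEnd ℂ) (circleMap 0 r θ ^ (m + 1) * G (circleMap 0 r θ)) := by
        intro θ
        have h5 : circleMap 0 r θ * (starRingEnd ℂ) (circleMap 0 r θ) = (r : ℂ) ^ 2 := by
          rw [Complex.mul_conj, Complex.normSq_eq_norm_sq, norm_circleMap_zero, abs_of_pos hr0]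
          push_cast; rfl
        have h6 : (r : ℂ) ^ (2 * (m + 1)) = circleMap 0 r θ ^ (m + 1) *
            (starRingEnd ℂ) (circleMap 0 r θ) ^ (m + 1) := by
          rw [← mul_pow, h5, pow_mul]
        have h7 : (starRingEnd ℂ) (circleMap 0 r θ) ≠ 0 := by
          simpa using hw0 θ
        have := hw0 θ
        rw [h6, map_mul, map_pow]
        field_simp
      simp_rw [h4]
      rw [intervalIntegral.integral_const_mul, h3, mul_zero]
    -- Adding the vanishing integral replaces `G` by `2 Re G`. As this is nonnegative, its absolute
    -- integral is computed by the mean value property.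
    have h3 : ∫ θ in (0 : ℝ)..2 * Real.pi,
        (circleMap 0 r θ ^ n)⁻¹ * ((2 * (G (circleMap 0 r θ)).re : ℝ) : ℂ) =
        2 * Real.pi * taylorCoeff n G := by
      have h4 := intervalIntegral.integral_add
        ((hwc.mul hGc).intervalIntegrable (μ := MeasureTheory.volume) 0 (2 * Real.pi))
        ((hwc.mul (Complex.continuous_conj.comp hGc)).intervalIntegrable
          (μ := MeasureTheory.volume) 0 (2 * Real.pi))
      simp only [Pi.mul_apply, Function.comp_apply] at h4
      rw [h1, h2, add_zero] at h4
      rw [← h4]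
      refine intervalIntegral.integral_congr fun θ _ => ?_
      simp only [← mul_add, Complex.add_conj]
    have h0 := integral_circleMap_pow_inv_mul hG hr0 hr1 0
    simp only [pow_zero, inv_one, one_mul, taylorCoeff_zero] at h0
    have h4 : ∫ θ in (0 : ℝ)..2 * Real.pi, (G (circleMap 0 r θ)).re = 2 * Real.pi * (G 0).re := by
      have := intervalIntegral.intervalIntegral_re
        (hGc.intervalIntegrable (μ := MeasureTheory.volume) 0 (2 * Real.pi))
      simp only [RCLike.re_to_complex] at this
      rw [this, h0]
      simp
    have h5 : ‖∫ θ in (0 : ℝ)..2 * Real.pi,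
        (circleMap 0 r θ ^ n)⁻¹ * ((2 * (G (circleMap 0 r θ)).re : ℝ) : ℂ)‖ ≤
        ∫ θ in (0 : ℝ)..2 * Real.pi, (r ^ n)⁻¹ * (2 * (G (circleMap 0 r θ)).re) := by
      refine intervalIntegral.norm_integral_le_of_norm_le Real.two_pi_pos.le ?_ ?_
      · refine Filter.Eventually.of_forall fun θ _ => ?_
        have : 0 ≤ (G (circleMap 0 r θ)).re := hre _ (by simpa [abs_of_pos hr0] using hr1)
        rw [norm_mul, norm_inv, norm_pow, norm_circleMap_zero, abs_of_pos hr0, Complex.norm_real,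
          Real.norm_of_nonneg (by positivity)]
      · exact (continuous_const.mul (continuous_const.mul
          (Complex.continuous_re.comp hGc))).intervalIntegrable _ _
    rw [h3, intervalIntegral.integral_const_mul, intervalIntegral.integral_const_mul, h4, norm_mul,
      norm_mul, Complex.norm_real, Real.norm_of_nonneg Real.pi_pos.le] at h5
    have hpi := Real.pi_pos
    have hrn : 0 < r ^ n := by positivity
    rw [inv_mul_eq_div, le_div_iff₀ hrn] at h5
    norm_num at h5
    nlinarith
  have hlim : Filter.Tendsto (fun r : ℝ => ‖taylorCoeff n G‖ * r ^ n) (nhdsWithin 1 (Set.Iio 1))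
      (nhds ‖taylorCoeff n G‖) := by
    have : Continuous fun r : ℝ => ‖taylorCoeff n G‖ * r ^ n := by fun_prop
    simpa using (this.tendsto 1).mono_left nhdsWithin_le_nhds
  refine le_of_tendsto hlim ?_
  filter_upwards [Ioo_mem_nhdsLT one_pos] with r hr using key r hr

/-! ### Stem functions and slice regularity -/

/-- Holomorphy on the unit disc of a function with values in the complexified quaternions. -/
structure IsHolomorphic (F : ℂ → ℍ[ℂ]) : Prop where
  re : DifferentiableOn ℂ (fun z => (F z).re) (ball 0 1)
  imI : DifferentiableOn ℂ (fun z => (F z).imI) (ball 0 1)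
  imJ : DifferentiableOn ℂ (fun z => (F z).imJ) (ball 0 1)
  imK : DifferentiableOn ℂ (fun z => (F z).imK) (ball 0 1)

/-- The complex derivative of a function with values in the complexified quaternions. -/
def derivStem (F : ℂ → ℍ[ℂ]) (z : ℂ) : ℍ[ℂ] :=
  ⟨deriv (fun z => (F z).re) z, deriv (fun z => (F z).imI) z, deriv (fun z => (F z).imJ) z,
    deriv (fun z => (F z).imK) z⟩

@[simp] theorem derivStem_re (F : ℂ → ℍ[ℂ]) (z : ℂ) :
    (derivStem F z).re = deriv (fun z => (F z).re) z := rfl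
@[simp] theorem derivStem_imI (F : ℂ → ℍ[ℂ]) (z : ℂ) :
    (derivStem F z).imI = deriv (fun z => (F z).imI) z := rfl
@[simp] theorem derivStem_imJ (F : ℂ → ℍ[ℂ]) (z : ℂ) :
    (derivStem F z).imJ = deriv (fun z => (F z).imJ) z := rfl
@[simp] theorem derivStem_imK (F : ℂ → ℍ[ℂ]) (z : ℂ) :
    (derivStem F z).imK = deriv (fun z => (F z).imK) z := rfl

theorem IsHolomorphic.derivStem {F : ℂ → ℍ[ℂ]} (hF : IsHolomorphic F) :
    IsHolomorphic (derivStem F) :=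
  ⟨hF.re.deriv isOpen_ball, hF.imI.deriv isOpen_ball, hF.imJ.deriv isOpen_ball,
    hF.imK.deriv isOpen_ball⟩

/-- The quaternion `j`. -/
def unitJ : ℍ[ℝ] := ⟨0, 0, 1, 0⟩

/-- The quaternion `k`. -/
def unitK : ℍ[ℝ] := ⟨0, 0, 0, 1⟩

@[simp] theorem unitI_re : unitI.re = 0 := rfl
@[simp] theorem unitI_imI : unitI.imI = 1 := rfl
@[simp] theorem unitI_imJ : unitI.imJ = 0 := rfl
@[simp] theorem unitI_imK : unitI.imK = 0 := rfl
@[simp] theorem unitJ_re : unitJ.re = 0 := rfl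
@[simp] theorem unitJ_imI : unitJ.imI = 0 := rfl
@[simp] theorem unitJ_imJ : unitJ.imJ = 1 := rfl
@[simp] theorem unitJ_imK : unitJ.imK = 0 := rfl
@[simp] theorem unitK_re : unitK.re = 0 := rfl
@[simp] theorem unitK_imI : unitK.imI = 0 := rfl
@[simp] theorem unitK_imJ : unitK.imJ = 0 := rfl
@[simp] theorem unitK_imK : unitK.imK = 1 := rfl

/-- The real linear map `a + i b ↦ (a + b I) e`. -/
def planeMap (I e : ℍ[ℝ]) : ℂ →L[ℝ] ℍ[ℝ] :=
  Complex.reCLM.smulRight e + Complex.imCLM.smulRight (I * e)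

theorem planeMap_apply (I e : ℍ[ℝ]) (z : ℂ) : planeMap I e z = z.re • e + z.im • (I * e) := rfl

theorem evalAt_eq_planeMap (I : ℍ[ℝ]) (w : ℍ[ℂ]) :
    evalAt I w = planeMap I 1 w.re + planeMap I unitI w.imI + planeMap I unitJ w.imJ +
      planeMap I unitK w.imK := by
  simp only [planeMap_apply, evalAt]
  ext <;> simp <;> ring

theorem mem_disc_iff {I : ℍ[ℝ]} (hI : I ∈ imaginaryUnits) (z : ℝ × ℝ) :
    z ∈ disc I ↔ Complex.equivRealProdCLM.symm z ∈ ball (0 : ℂ) 1 := by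
  rw [disc, Set.mem_ofPred_eq, norm_add_smul_unit hI, mem_ball_zero_iff]
  rfl

theorem isOpen_disc {I : ℍ[ℝ]} (hI : I ∈ imaginaryUnits) : IsOpen (disc I) := by
  have : disc I = Complex.equivRealProdCLM.symm ⁻¹' ball (0 : ℂ) 1 := by
    ext z; exact mem_disc_iff hI z
  rw [this]
  exact isOpen_ball.preimage Complex.equivRealProdCLM.symm.continuous

/-- `f` is induced on the ball by the stem function `F`. -/
def IsInduced (f : ℍ[ℝ] → ℍ[ℝ]) (F : ℂ → ℍ[ℂ]) : Prop :=
  ∀ I ∈ imaginaryUnits, ∀ z ∈ disc I,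
    restrict f I z = evalAt I (F (Complex.equivRealProdCLM.symm z))

theorem contDiffOn_planeMap_comp {g : ℂ → ℂ} (hg : DifferentiableOn ℂ g (ball 0 1)) {I : ℍ[ℝ]}
    (hI : I ∈ imaginaryUnits) (e : ℍ[ℝ]) :
    ContDiffOn ℝ 1 (fun z => planeMap I e (g (Complex.equivRealProdCLM.symm z))) (disc I) := by
  have h1 : ContDiffOn ℝ 1 g (ball 0 1) := (hg.contDiffOn isOpen_ball).restrict_scalars ℝ
  have h2 : ContDiffOn ℝ 1 (fun z => g (Complex.equivRealProdCLM.symm z)) (disc I) :=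
    h1.comp Complex.equivRealProdCLM.symm.contDiff.contDiffOn fun z hz => (mem_disc_iff hI z).1 hz
  exact (planeMap I e).contDiff.comp_contDiffOn h2

theorem hasFDerivAt_planeMap_comp {g : ℂ → ℂ} (hg : DifferentiableOn ℂ g (ball 0 1)) {I : ℍ[ℝ]}
    (hI : I ∈ imaginaryUnits) (e : ℍ[ℝ]) {z : ℝ × ℝ} (hz : z ∈ disc I) :
    HasFDerivAt (fun z => planeMap I e (g (Complex.equivRealProdCLM.symm z)))
      ((planeMap I e).comp (((ContinuousLinearMap.toSpanSingleton ℂ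
        (deriv g (Complex.equivRealProdCLM.symm z))).restrictScalars ℝ).comp
        (Complex.equivRealProdCLM.symm : (ℝ × ℝ) →L[ℝ] ℂ))) z := by
  have h1 := (hg.differentiableAt (isOpen_ball.mem_nhds ((mem_disc_iff hI z).1 hz))).hasDerivAt
  have h2 := h1.hasFDerivAt.restrictScalars ℝ
  have h3 := h2.comp z Complex.equivRealProdCLM.symm.hasFDerivAt
  exact (planeMap I e).hasFDerivAt.comp z h3

/-- Chain rule in the four components. Complex linearity in `v` is what makes the `y` derivative
equal to `I` times the `x` derivative, that is, the Cauchy-Riemann equation. -/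
theorem IsInduced.hasFDerivAt {f : ℍ[ℝ] → ℍ[ℝ]} {F : ℂ → ℍ[ℂ]} (h : IsInduced f F)
    (hF : IsHolomorphic F) {I : ℍ[ℝ]} (hI : I ∈ imaginaryUnits) {z : ℝ × ℝ} (hz : z ∈ disc I) :
    ∃ L : (ℝ × ℝ) →L[ℝ] ℍ[ℝ], HasFDerivAt (restrict f I) L z ∧ ∀ v : ℝ × ℝ, L v = evalAt I
      ((Complex.equivRealProdCLM.symm v : ℂ) *
        derivStem F (Complex.equivRealProdCLM.symm z)) := by
  have h0 := (((hasFDerivAt_planeMap_comp hF.re hI 1 hz).add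
    (hasFDerivAt_planeMap_comp hF.imI hI unitI hz)).add
    (hasFDerivAt_planeMap_comp hF.imJ hI unitJ hz)).add
    (hasFDerivAt_planeMap_comp hF.imK hI unitK hz)
  refine ⟨_, h0.congr_of_eventuallyEq ?_, fun v => ?_⟩
  · filter_upwards [(isOpen_disc hI).mem_nhds hz] with w hw
    rw [h I hI w hw, evalAt_eq_planeMap]
    rfl
  · rw [evalAt_eq_planeMap]
    simp

theorem IsInduced.partialX_eq {f : ℍ[ℝ] → ℍ[ℝ]} {F : ℂ → ℍ[ℂ]} (h : IsInduced f F)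
    (hF : IsHolomorphic F) {I : ℍ[ℝ]} (hI : I ∈ imaginaryUnits) {z : ℝ × ℝ} (hz : z ∈ disc I) :
    partialX f I z = evalAt I (derivStem F (Complex.equivRealProdCLM.symm z)) := by
  obtain ⟨L, hL, hv⟩ := h.hasFDerivAt hF hI hz
  rw [partialX, hL.fderiv, hv]
  congr 1
  have : Complex.equivRealProdCLM.symm ((1, 0) : ℝ × ℝ) = 1 := by
    apply Complex.ext <;> simp
  rw [this]; simp

theorem IsInduced.dbar_eq_zero {f : ℍ[ℝ] → ℍ[ℝ]} {F : ℂ → ℍ[ℂ]} (h : IsInduced f F)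
    (hF : IsHolomorphic F) {I : ℍ[ℝ]} (hI : I ∈ imaginaryUnits) {z : ℝ × ℝ} (hz : z ∈ disc I) :
    dbar f I z = 0 := by
  have hX := h.partialX_eq hF hI hz
  obtain ⟨L, hL, hv⟩ := h.hasFDerivAt hF hI hz
  have : Complex.equivRealProdCLM.symm ((0, 1) : ℝ × ℝ) = Complex.I := by
    apply Complex.ext <;> simp
  have hI' : I * I = -1 := hI
  rw [dbar, hX, partialY, hL.fderiv, hv, this, evalAt_coe_mul hI, evalAt_coe, ← mul_assoc]
  simp [hI']

theorem IsInduced.isSliceRegular {f : ℍ[ℝ] → ℍ[ℝ]} {F : ℂ → ℍ[ℂ]} (h : IsInduced f F)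
    (hF : IsHolomorphic F) : IsSliceRegular f := by
  refine fun I hI => ⟨?_, fun z hz => h.dbar_eq_zero hF hI hz⟩
  have h0 := (((contDiffOn_planeMap_comp hF.re hI 1).add
    (contDiffOn_planeMap_comp hF.imI hI unitI)).add
    (contDiffOn_planeMap_comp hF.imJ hI unitJ)).add
    (contDiffOn_planeMap_comp hF.imK hI unitK)
  refine h0.congr fun z hz => ?_
  rw [h I hI z hz, evalAt_eq_planeMap]

/-- The slice derivative of an induced function is its derivative in the real direction. -/
theorem IsInduced.sliceDeriv_eq_partialX {f : ℍ[ℝ] → ℍ[ℝ]} {F : ℂ → ℍ[ℂ]} (h : IsInduced f F)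
    (hF : IsHolomorphic F) {I : ℍ[ℝ]} (hI : I ∈ imaginaryUnits) {x y : ℝ} (hz : (x, y) ∈ disc I) :
    sliceDeriv f ((x : ℍ[ℝ]) + y • I) = partialX f I (x, y) := by
  rw [sliceDeriv_eq_dI (h.isSliceRegular hF) hI hz,
    dI_eq_partialX (h.dbar_eq_zero hF hI hz)]

theorem IsInduced.sliceDeriv_eq {f : ℍ[ℝ] → ℍ[ℝ]} {F : ℂ → ℍ[ℂ]} (h : IsInduced f F)
    (hF : IsHolomorphic F) {I : ℍ[ℝ]} (hI : I ∈ imaginaryUnits) {x y : ℝ} (hz : (x, y) ∈ disc I) :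
    sliceDeriv f ((x : ℍ[ℝ]) + y • I) = evalAt I (derivStem F ⟨x, y⟩) := by
  rw [h.sliceDeriv_eq_partialX hF hI hz, h.partialX_eq hF hI hz]
  rfl

/-! ### Stem functions of quaternionic power series -/

/-- The stem function of the quaternionic power series with coefficients `p`. -/
def stem (p : ℕ → ℍ[ℝ]) (z : ℂ) : ℍ[ℂ] :=
  ⟨powerSum (fun k => (p k).re) z, powerSum (fun k => (p k).imI) z,
    powerSum (fun k => (p k).imJ) z, powerSum (fun k => (p k).imK) z⟩

@[simp] theorem stem_re (p : ℕ → ℍ[ℝ]) (z : ℂ) :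
    (stem p z).re = powerSum (fun k => (p k).re) z := rfl
@[simp] theorem stem_imI (p : ℕ → ℍ[ℝ]) (z : ℂ) :
    (stem p z).imI = powerSum (fun k => (p k).imI) z := rfl
@[simp] theorem stem_imJ (p : ℕ → ℍ[ℝ]) (z : ℂ) :
    (stem p z).imJ = powerSum (fun k => (p k).imJ) z := rfl
@[simp] theorem stem_imK (p : ℕ → ℍ[ℝ]) (z : ℂ) :
    (stem p z).imK = powerSum (fun k => (p k).imK) z := rfl

/-- A quaternionic power series converging absolutely on the unit ball. -/
def SummableOnBall (p : ℕ → ℍ[ℝ]) : Prop :=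
  ∀ r : ℝ, 0 ≤ r → r < 1 → Summable fun k => ‖p k‖ * r ^ k

theorem sum_sq_eq_norm_sq (c : ℍ[ℝ]) :
    c.re ^ 2 + c.imI ^ 2 + c.imJ ^ 2 + c.imK ^ 2 = ‖c‖ ^ 2 := by
  rw [sq ‖c‖, ← Quaternion.normSq_eq_norm_mul_self, Quaternion.normSq_def']

theorem SummableOnBall.component {p : ℕ → ℍ[ℝ]} (hp : SummableOnBall p) {c : ℍ[ℝ] → ℝ}
    (hc : ∀ a, |c a| ≤ ‖a‖) : SummableOnDisc fun k => (c (p k) : ℂ) := by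
  intro r h0 h1
  refine (hp r h0 h1).of_nonneg_of_le (fun k => by positivity) fun k => ?_
  rw [Complex.norm_real, Real.norm_eq_abs]
  exact mul_le_mul_of_nonneg_right (hc _) (by positivity)

theorem abs_re_le (a : ℍ[ℝ]) : |a.re| ≤ ‖a‖ :=
  abs_le_of_sq_le_sq (by nlinarith [sum_sq_eq_norm_sq a]) (norm_nonneg a)
theorem abs_imI_le (a : ℍ[ℝ]) : |a.imI| ≤ ‖a‖ :=
  abs_le_of_sq_le_sq (by nlinarith [sum_sq_eq_norm_sq a]) (norm_nonneg a)
theorem abs_imJ_le (a : ℍ[ℝ]) : |a.imJ| ≤ ‖a‖ :=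
  abs_le_of_sq_le_sq (by nlinarith [sum_sq_eq_norm_sq a]) (norm_nonneg a)
theorem abs_imK_le (a : ℍ[ℝ]) : |a.imK| ≤ ‖a‖ :=
  abs_le_of_sq_le_sq (by nlinarith [sum_sq_eq_norm_sq a]) (norm_nonneg a)

theorem SummableOnBall.isHolomorphic_stem {p : ℕ → ℍ[ℝ]} (hp : SummableOnBall p) :
    IsHolomorphic (stem p) :=
  ⟨(hp.component abs_re_le).differentiableOn, (hp.component abs_imI_le).differentiableOn,
    (hp.component abs_imJ_le).differentiableOn, (hp.component abs_imK_le).differentiableOn⟩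

theorem add_smul_unit_pow {I : ℍ[ℝ]} (hI : I ∈ imaginaryUnits) (x y : ℝ) (k : ℕ) :
    ((x : ℍ[ℝ]) + y • I) ^ k =
      (((⟨x, y⟩ : ℂ) ^ k).re : ℍ[ℝ]) + ((⟨x, y⟩ : ℂ) ^ k).im • I := by
  rw [← evalAt_coe]
  have h1 : (x : ℍ[ℝ]) + y • I = evalAt I ((⟨x, y⟩ : ℂ) : ℍ[ℂ]) := by rw [evalAt_coe]
  rw [h1]
  induction k with
  | zero => rw [pow_zero, pow_zero, evalAt_coe]; simp
  | succ k ih => rw [pow_succ', ih, ← evalAt_coe_mul hI, ← Quaternion.coe_mul, ← pow_succ']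

theorem SummableOnBall.hasSum {p : ℕ → ℍ[ℝ]} (hp : SummableOnBall p) {I : ℍ[ℝ]}
    (hI : I ∈ imaginaryUnits) {x y : ℝ} (hz : (x, y) ∈ disc I) :
    HasSum (fun k => ((x : ℍ[ℝ]) + y • I) ^ k * p k) (evalAt I (stem p ⟨x, y⟩)) := by
  have hz' : ‖(⟨x, y⟩ : ℂ)‖ < 1 := by rw [← norm_add_smul_unit hI]; exact hz
  have h : ∀ (c : ℍ[ℝ] → ℝ), (∀ a, |c a| ≤ ‖a‖) → ∀ e : ℍ[ℝ],
      HasSum (fun k => planeMap I e (c (p k) * (⟨x, y⟩ : ℂ) ^ k))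
        (planeMap I e (powerSum (fun k => c (p k)) ⟨x, y⟩)) := fun c hc e =>
    ((hp.component hc).summable hz').hasSum.mapL (planeMap I e)
  have h0 := (((h _ abs_re_le 1).add (h _ abs_imI_le unitI)).add (h _ abs_imJ_le unitJ)).add
    (h _ abs_imK_le unitK)
  rw [evalAt_eq_planeMap]
  refine h0.congr_fun fun k => ?_
  rw [add_smul_unit_pow hI]
  simp only [planeMap_apply]
  ext <;> simp <;> ring

theorem SummableOnBall.isInduced {p : ℕ → ℍ[ℝ]} (hp : SummableOnBall p) {f : ℍ[ℝ] → ℍ[ℝ]}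
    (hf : ∀ q : ℍ[ℝ], ‖q‖ < 1 → HasSum (fun k => q ^ k * p k) (f q)) : IsInduced f (stem p) :=
  fun _ hI _ hz => (hf _ hz).unique (hp.hasSum hI hz)

/-- Real points suffice, and in finite dimension summability is absolute. -/
theorem summableOnBall_of_hasSum {p : ℕ → ℍ[ℝ]}
    (hf : ∀ q : ℍ[ℝ], ‖q‖ < 1 → Summable fun k => q ^ k * p k) : SummableOnBall p := by
  intro r h0 h1
  have h := (hf (r : ℍ[ℝ]) (by rwa [Quaternion.norm_coe, Real.norm_of_nonneg h0])).norm
  refine h.congr fun k => ?_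
  rw [norm_mul, norm_pow, Quaternion.norm_coe, Real.norm_of_nonneg h0, mul_comm]

/-! ### Products and Taylor coefficients of stem functions -/

theorem IsHolomorphic.mul {F G : ℂ → ℍ[ℂ]} (hF : IsHolomorphic F) (hG : IsHolomorphic G) :
    IsHolomorphic fun z => F z * G z := by
  obtain ⟨f0, f1, f2, f3⟩ := hF
  obtain ⟨g0, g1, g2, g3⟩ := hG
  constructor
  · simp only [Quaternion.re_mul]
    exact (((f0.mul g0).sub (f1.mul g1)).sub (f2.mul g2)).sub (f3.mul g3)
  · simp only [Quaternion.imI_mul]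
    exact (((f0.mul g1).add (f1.mul g0)).add (f2.mul g3)).sub (f3.mul g2)
  · simp only [Quaternion.imJ_mul]
    exact (((f0.mul g2).sub (f1.mul g3)).add (f2.mul g0)).add (f3.mul g1)
  · simp only [Quaternion.imK_mul]
    exact (((f0.mul g3).add (f1.mul g2)).sub (f2.mul g1)).add (f3.mul g0)

theorem IsHolomorphic.star {F : ℂ → ℍ[ℂ]} (hF : IsHolomorphic F) :
    IsHolomorphic fun z => star (F z) := by
  obtain ⟨f0, f1, f2, f3⟩ := hF
  constructor
  · simpa using f0
  · simpa using f1
  · simpa using f2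
  · simpa using f3

theorem isHolomorphic_coe {g : ℂ → ℂ} (hg : DifferentiableOn ℂ g (ball 0 1)) :
    IsHolomorphic fun z => (g z : ℍ[ℂ]) := by
  constructor
  · simpa using hg
  all_goals simp

theorem IsHolomorphic.normSq {F : ℂ → ℍ[ℂ]} (hF : IsHolomorphic F) :
    DifferentiableOn ℂ (fun z => Quaternion.normSq (F z)) (ball 0 1) := by
  simp only [Quaternion.normSq_def']
  exact (((hF.re.pow 2).add (hF.imI.pow 2)).add (hF.imJ.pow 2)).add (hF.imK.pow 2)

/-- The Taylor coefficients at the origin of a function with values in the complexified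
quaternions. -/
def taylorCoeffQ (n : ℕ) (F : ℂ → ℍ[ℂ]) : ℍ[ℂ] :=
  ⟨taylorCoeff n fun z => (F z).re, taylorCoeff n fun z => (F z).imI,
    taylorCoeff n fun z => (F z).imJ, taylorCoeff n fun z => (F z).imK⟩

@[simp] theorem taylorCoeffQ_re (n : ℕ) (F : ℂ → ℍ[ℂ]) :
    (taylorCoeffQ n F).re = taylorCoeff n fun z => (F z).re := rfl
@[simp] theorem taylorCoeffQ_imI (n : ℕ) (F : ℂ → ℍ[ℂ]) :
    (taylorCoeffQ n F).imI = taylorCoeff n fun z => (F z).imI := rfl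
@[simp] theorem taylorCoeffQ_imJ (n : ℕ) (F : ℂ → ℍ[ℂ]) :
    (taylorCoeffQ n F).imJ = taylorCoeff n fun z => (F z).imJ := rfl
@[simp] theorem taylorCoeffQ_imK (n : ℕ) (F : ℂ → ℍ[ℂ]) :
    (taylorCoeffQ n F).imK = taylorCoeff n fun z => (F z).imK := rfl

theorem sum_re {ι : Type*} (s : Finset ι) (g : ι → ℍ[ℂ]) :
    (∑ i ∈ s, g i).re = ∑ i ∈ s, (g i).re := map_sum (QuaternionAlgebra.reₗ (-1 : ℂ) 0 (-1)) g s
theorem sum_imI {ι : Type*} (s : Finset ι) (g : ι → ℍ[ℂ]) :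
    (∑ i ∈ s, g i).imI = ∑ i ∈ s, (g i).imI := map_sum (QuaternionAlgebra.imIₗ (-1 : ℂ) 0 (-1)) g s
theorem sum_imJ {ι : Type*} (s : Finset ι) (g : ι → ℍ[ℂ]) :
    (∑ i ∈ s, g i).imJ = ∑ i ∈ s, (g i).imJ := map_sum (QuaternionAlgebra.imJₗ (-1 : ℂ) 0 (-1)) g s
theorem sum_imK {ι : Type*} (s : Finset ι) (g : ι → ℍ[ℂ]) :
    (∑ i ∈ s, g i).imK = ∑ i ∈ s, (g i).imK := map_sum (QuaternionAlgebra.imKₗ (-1 : ℂ) 0 (-1)) g s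

/-- The complex variable is central in `ℍ[ℂ]`, so this is the Cauchy product with the order of
factors kept: the regular product. -/
theorem taylorCoeffQ_mul {F G : ℂ → ℍ[ℂ]} (hF : IsHolomorphic F) (hG : IsHolomorphic G) (n : ℕ) :
    taylorCoeffQ n (fun z => F z * G z) =
      ∑ i ∈ range (n + 1), taylorCoeffQ i F * taylorCoeffQ (n - i) G := by
  obtain ⟨f0, f1, f2, f3⟩ := hF
  obtain ⟨g0, g1, g2, g3⟩ := hG
  ext
  · simp only [sum_re, taylorCoeffQ_re, taylorCoeffQ_imI, taylorCoeffQ_imJ, taylorCoeffQ_imK,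
      Quaternion.re_mul, sum_sub_distrib, ← taylorCoeff_mul, *]
    rw [taylorCoeff_sub (((f0.fun_mul g0).fun_sub (f1.fun_mul g1)).fun_sub (f2.fun_mul g2))
        (f3.fun_mul g3),
      taylorCoeff_sub ((f0.fun_mul g0).fun_sub (f1.fun_mul g1)) (f2.fun_mul g2),
      taylorCoeff_sub (f0.fun_mul g0) (f1.fun_mul g1)]
  · simp only [sum_imI, taylorCoeffQ_re, taylorCoeffQ_imI, taylorCoeffQ_imJ, taylorCoeffQ_imK,
      Quaternion.imI_mul, sum_sub_distrib, sum_add_distrib, ← taylorCoeff_mul, *]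
    rw [taylorCoeff_sub (((f0.fun_mul g1).fun_add (f1.fun_mul g0)).fun_add (f2.fun_mul g3))
        (f3.fun_mul g2),
      taylorCoeff_add ((f0.fun_mul g1).fun_add (f1.fun_mul g0)) (f2.fun_mul g3),
      taylorCoeff_add (f0.fun_mul g1) (f1.fun_mul g0)]
  · simp only [sum_imJ, taylorCoeffQ_re, taylorCoeffQ_imI, taylorCoeffQ_imJ, taylorCoeffQ_imK,
      Quaternion.imJ_mul, sum_sub_distrib, sum_add_distrib, ← taylorCoeff_mul, *]
    rw [taylorCoeff_add (((f0.fun_mul g2).fun_sub (f1.fun_mul g3)).fun_add (f2.fun_mul g0))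
        (f3.fun_mul g1),
      taylorCoeff_add ((f0.fun_mul g2).fun_sub (f1.fun_mul g3)) (f2.fun_mul g0),
      taylorCoeff_sub (f0.fun_mul g2) (f1.fun_mul g3)]
  · simp only [sum_imK, taylorCoeffQ_re, taylorCoeffQ_imI, taylorCoeffQ_imJ, taylorCoeffQ_imK,
      Quaternion.imK_mul, sum_sub_distrib, sum_add_distrib, ← taylorCoeff_mul, *]
    rw [taylorCoeff_add (((f0.fun_mul g3).fun_add (f1.fun_mul g2)).fun_sub (f2.fun_mul g1))
        (f3.fun_mul g0),
      taylorCoeff_sub ((f0.fun_mul g3).fun_add (f1.fun_mul g2)) (f2.fun_mul g1),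
      taylorCoeff_add (f0.fun_mul g3) (f1.fun_mul g2)]

theorem taylorCoeffQ_congr {F G : ℂ → ℍ[ℂ]} (h : Set.EqOn F G (ball 0 1)) (n : ℕ) :
    taylorCoeffQ n F = taylorCoeffQ n G := by
  ext <;> simp only [taylorCoeffQ_re, taylorCoeffQ_imI, taylorCoeffQ_imJ, taylorCoeffQ_imK] <;>
    exact taylorCoeff_congr (fun z hz => by simp only [h hz]) n

theorem taylorCoeffQ_zero (F : ℂ → ℍ[ℂ]) : taylorCoeffQ 0 F = F 0 := by
  ext <;> simp [taylorCoeff_zero]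

theorem SummableOnBall.taylorCoeffQ_stem {p : ℕ → ℍ[ℝ]} (hp : SummableOnBall p) (n : ℕ) :
    taylorCoeffQ n (stem p) = complexify (p n) := by
  ext
  · exact (hp.component abs_re_le).taylorCoeff_powerSum n
  · exact (hp.component abs_imI_le).taylorCoeff_powerSum n
  · exact (hp.component abs_imJ_le).taylorCoeff_powerSum n
  · exact (hp.component abs_imK_le).taylorCoeff_powerSum n

theorem taylorCoeffQ_derivStem (F : ℂ → ℍ[ℂ]) (n : ℕ) :
    taylorCoeffQ n (derivStem F) = (n + 1 : ℕ) • taylorCoeffQ (n + 1) F := by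
  ext <;> simp <;> exact_mod_cast taylorCoeff_deriv _ n

theorem IsHolomorphic.planePart {F : ℂ → ℍ[ℂ]} (hF : IsHolomorphic F) (I : ℍ[ℝ]) :
    DifferentiableOn ℂ (fun z => planePart I (F z)) (ball 0 1) :=
  hF.re.add ((((hF.imI.const_mul _).add (hF.imJ.const_mul _)).add (hF.imK.const_mul _)).const_mul _)

theorem taylorCoeff_planePart {F : ℂ → ℍ[ℂ]} (hF : IsHolomorphic F) (I : ℍ[ℝ]) (n : ℕ) :
    taylorCoeff n (fun z => planePart I (F z)) = planePart I (taylorCoeffQ n F) := by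
  have h1 := hF.imI.const_mul (I.imI : ℂ)
  have h2 := hF.imJ.const_mul (I.imJ : ℂ)
  have h3 := hF.imK.const_mul (I.imK : ℂ)
  simp only [SliceStarlike.planePart]
  rw [taylorCoeff_add hF.re (((h1.fun_add h2).fun_add h3).const_mul _), taylorCoeff_const_mul,
    taylorCoeff_add (h1.fun_add h2) h3, taylorCoeff_add h1 h2, taylorCoeff_const_mul,
    taylorCoeff_const_mul, taylorCoeff_const_mul]
  rfl

/-! ### The coefficient bound for slice starlike functions -/

/-- The coefficients of a slice regular function of positive real part with value one at zero. -/
theorem norm_coeff_le_two {B : ℂ → ℍ[ℂ]} (hB : IsHolomorphic B) {c : ℕ → ℍ[ℝ]}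
    (hc : ∀ n, taylorCoeffQ n B = complexify (c n)) (h0 : c 0 = 1)
    (hre : ∀ z ∈ ball (0 : ℂ) 1, ∀ I ∈ imaginaryUnits, 0 < (evalAt I (B z)).re)
    {n : ℕ} (hn : n ≠ 0) : ‖c n‖ ≤ 2 := by
  obtain ⟨I, hI, hcI⟩ := exists_norm_planePart (c n)
  have h := norm_taylorCoeff_le_of_re_nonneg (hB.planePart I)
    (fun z hz => (planePart_re hI (B z)).symm ▸ (hre z hz I hI).le) hn
  rw [taylorCoeff_planePart hB, hc, hcI, ← taylorCoeffQ_zero B, hc, h0] at h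
  simpa [planePart] using h

/-- A solution of `a * c = ∑ (n + 1) a_n` with bounded coefficients has linear growth. -/
theorem norm_le_of_convolution {a c : ℕ → ℍ[ℝ]} (ha : a 0 = 1) (hc0 : c 0 = 1)
    (hc : ∀ n, n ≠ 0 → ‖c n‖ ≤ 2)
    (h : ∀ n, ∑ i ∈ range (n + 1), a i * c (n - i) = (n + 1 : ℕ) • a n) (n : ℕ) :
    ‖a n‖ ≤ n + 1 := by
  induction n using Nat.strong_induction_on with
  | _ n ih =>
    rcases eq_or_ne n 0 with rfl | hn
    · simp [ha]
    -- The term `i = n` is `a n` and cancels one of the `n + 1` copies on the right.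
    have h1 : ∑ i ∈ range n, a i * c (n - i) = n • a n := by
      have := h n
      rw [sum_range_succ, Nat.sub_self, hc0, mul_one, succ_nsmul] at this
      exact add_right_cancel this
    have h2 : (n : ℝ) * ‖a n‖ ≤ ∑ i ∈ range n, ((i : ℝ) + 1) * 2 := by
      have : (n : ℝ) * ‖a n‖ = ‖∑ i ∈ range n, a i * c (n - i)‖ := by
        rw [h1, ← Nat.cast_smul_eq_nsmul ℝ, norm_smul, Real.norm_natCast]
      rw [this]
      refine norm_sum_le_of_le _ fun i hi => ?_
      have hi' := mem_range.1 hi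
      rw [norm_mul]
      exact mul_le_mul (ih i hi') (hc _ (by omega)) (norm_nonneg _) (by positivity)
    have h3 : ∀ m : ℕ, ∑ i ∈ range m, ((i : ℝ) + 1) * 2 = m * (m + 1) := by
      intro m
      induction m with
      | zero => simp
      | succ m ihm => rw [sum_range_succ, ihm]; push_cast; ring
    rw [h3] at h2
    exact le_of_mul_le_mul_left h2 (by positivity)

/-- A priori the coefficients of the quotient `B` are only complexified. Since `a 0 = 1`, the
convolution can be solved recursively for `C n`, which stays in the subring of true quaternions. -/
theorem mem_range_of_convolution {a : ℕ → ℍ[ℝ]} (ha : a 0 = 1) {C : ℕ → ℍ[ℂ]}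
    {d : ℕ → ℍ[ℝ]}
    (h : ∀ n, ∑ i ∈ range (n + 1), complexify (a i) * C (n - i) = complexify (d n)) (n : ℕ) :
    C n ∈ complexify.range := by
  induction n using Nat.strong_induction_on with
  | _ n ih =>
    have h1 := h n
    rw [sum_range_succ', ha, map_one, one_mul, Nat.sub_zero, ← eq_sub_iff_add_eq'] at h1
    rw [h1]
    refine sub_mem ⟨d n, rfl⟩ (sum_mem fun i hi => mul_mem ⟨a (i + 1), rfl⟩ (ih _ ?_))
    have := mem_range.1 hi
    omega

theorem evalAt_complexify (I a : ℍ[ℝ]) : evalAt I (complexify a) = a := by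
  have h1 : imQ (complexify a) = 0 := by ext <;> simp
  have h2 : reQ (complexify a) = a := by ext <;> simp
  rw [evalAt, h1, h2, mul_zero, add_zero]

/-- The coefficient bound for a function induced by an invertible stem function `A`, when the
quotient of the stem functions has positive real part. -/
theorem norm_coeff_le_of_re_pos {a : ℕ → ℍ[ℝ]} (ha0 : a 0 = 1) {A D : ℂ → ℍ[ℂ]}
    (hA : IsHolomorphic A) (hD : IsHolomorphic D)
    (hAa : ∀ n, taylorCoeffQ n A = complexify (a n))
    (hDa : ∀ n, taylorCoeffQ n D = complexify ((n + 1 : ℕ) • a n))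
    (hne : ∀ z ∈ ball (0 : ℂ) 1, ∀ I ∈ imaginaryUnits, evalAt I (A z) ≠ 0)
    (hre : ∀ z ∈ ball (0 : ℂ) 1, ∀ I ∈ imaginaryUnits,
      0 < ((evalAt I (A z))⁻¹ * evalAt I (D z)).re) (n : ℕ) : ‖a n‖ ≤ n + 1 := by
  have hN : ∀ z ∈ ball (0 : ℂ) 1, Quaternion.normSq (A z) ≠ 0 := fun z hz =>
    normSq_ne_zero_of_evalAt (hne z hz)
  -- `normSq A` is central and has no zero, so `(normSq A)⁻¹ * star A` is a holomorphic inverse of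
  -- `A` and `B` is the regular quotient.
  obtain ⟨B, hB, hBdef⟩ : ∃ B : ℂ → ℍ[ℂ], IsHolomorphic B ∧ ∀ z, B z =
      (((Quaternion.normSq (A z))⁻¹ : ℂ) : ℍ[ℂ]) * (star (A z) * D z) :=
    ⟨_, (isHolomorphic_coe (hA.normSq.fun_inv hN)).mul (hA.star.mul hD), fun _ => rfl⟩
  have hAB : ∀ z ∈ ball (0 : ℂ) 1, A z * B z = D z := by
    intro z hz
    rw [hBdef, ← mul_assoc, ← Quaternion.coe_commutes, mul_assoc, ← mul_assoc (A z),
      Quaternion.self_mul_star, ← mul_assoc, ← Quaternion.coe_mul, inv_mul_cancel₀ (hN z hz),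
      Quaternion.coe_one, one_mul]
  have hconv : ∀ n, ∑ i ∈ range (n + 1), complexify (a i) * taylorCoeffQ (n - i) B =
      complexify ((n + 1 : ℕ) • a n) := by
    intro n
    rw [← hDa, ← taylorCoeffQ_congr hAB n, taylorCoeffQ_mul hA hB]
    simp only [hAa]
  obtain ⟨c, hc⟩ : ∃ c : ℕ → ℍ[ℝ], ∀ n, complexify (c n) = taylorCoeffQ n B :=
    Classical.axiomOfChoice fun n =>
      RingHom.mem_range.1 (mem_range_of_convolution
        (C := fun n => taylorCoeffQ n B) (d := fun n => (n + 1 : ℕ) • a n) ha0 hconv n)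
  have hconv' : ∀ n, ∑ i ∈ range (n + 1), a i * c (n - i) = (n + 1 : ℕ) • a n := by
    intro n
    apply complexify_injective
    rw [← hconv, map_sum]
    simp only [map_mul, hc]
  have hc0 : c 0 = 1 := by simpa [ha0] using hconv' 0
  have hBre : ∀ z ∈ ball (0 : ℂ) 1, ∀ I ∈ imaginaryUnits, 0 < (evalAt I (B z)).re :=
    fun z hz I hI => evalAt_re_pos_of_mul (hAB z hz) (hN z hz) (hre z hz) hI
  exact norm_le_of_convolution ha0 hc0
    (fun n hn => norm_coeff_le_two hB (fun n => (hc n).symm) hc0 hBre hn) hconv' n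

/-- Prepend a coefficient to a sequence of coefficients. -/
def consCoeff (a0 : ℍ[ℝ]) (a : ℕ → ℍ[ℝ]) : ℕ → ℍ[ℝ]
  | 0 => a0
  | k + 1 => a k

theorem IsSliceStarlike.norm_coeff_le {f : ℍ[ℝ] → ℍ[ℝ]} {p : ℕ → ℍ[ℝ]} (hf : IsSliceStarlike f)
    (hp : ∀ q : ℍ[ℝ], ‖q‖ < 1 → HasSum (fun k : ℕ => q ^ (k + 2) * p (k + 2)) (f q - q)) (k : ℕ) :
    ‖p (k + 2)‖ ≤ k + 2 := by
  -- `a` lists the coefficients of `f(q) / q` and `b` those of `f`; `p 0` and `p 1` play no role.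
  set a := consCoeff 1 fun k => p (k + 2) with ha
  set b := consCoeff 0 a with hb
  have ha1 : ∀ q : ℍ[ℝ], ‖q‖ < 1 → HasSum (fun k => q ^ (k + 1) * a k) (f q) := by
    intro q hq
    have h := (hasSum_nat_add_iff (f := fun k => q ^ (k + 1) * a k) 1).1 (hp q hq)
    simpa [ha, consCoeff] using h
  have hb1 : ∀ q : ℍ[ℝ], ‖q‖ < 1 → HasSum (fun k => q ^ k * b k) (f q) := by
    intro q hq
    have h := (hasSum_nat_add_iff (f := fun k => q ^ k * b k) 1).1 (ha1 q hq)
    simpa [hb, consCoeff] using h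
  have hbs : SummableOnBall b := summableOnBall_of_hasSum fun q hq => (hb1 q hq).summable
  have has : SummableOnBall a := by
    intro r h0 h1
    -- Shifting the series costs a division by the radius; the larger radius `(r + 1) / 2` is
    -- nonzero even when `r = 0`.
    have h := (summable_nat_add_iff 1).2 (hbs ((r + 1) / 2) (by linarith) (by linarith))
    refine (h.mul_left ((r + 1) / 2)⁻¹).of_nonneg_of_le (fun k => by positivity) fun k => ?_
    have h2 : ((r + 1) / 2)⁻¹ * (‖b (k + 1)‖ * ((r + 1) / 2) ^ (k + 1)) =
        ‖a k‖ * ((r + 1) / 2) ^ k := by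
      have : (r + 1) / 2 ≠ 0 := by linarith
      rw [pow_succ', mul_left_comm, inv_mul_cancel_left₀ this]
      rfl
    rw [h2]
    gcongr
    linarith
  have hind : IsInduced f (stem b) := hbs.isInduced hb1
  have hhol := hbs.isHolomorphic_stem
  have hD : ∀ n, taylorCoeffQ n (derivStem (stem b)) = complexify ((n + 1 : ℕ) • a n) := by
    intro n
    rw [taylorCoeffQ_derivStem, hbs.taylorCoeffQ_stem, map_nsmul]
    rfl
  have hA0 : ∀ I, evalAt I (stem a 0) = 1 := fun I => by
    rw [← taylorCoeffQ_zero (stem a), has.taylorCoeffQ_stem, evalAt_complexify]; rfl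
  have hD0 : ∀ I, evalAt I (derivStem (stem b) 0) = 1 := fun I => by
    rw [← taylorCoeffQ_zero (derivStem (stem b)), hD, evalAt_complexify, zero_add, one_smul]; rfl
  have hfac : ∀ I ∈ imaginaryUnits, ∀ x y : ℝ, (x, y) ∈ disc I →
      f ((x : ℍ[ℝ]) + y • I) = ((x : ℍ[ℝ]) + y • I) * evalAt I (stem a ⟨x, y⟩) := by
    intro I hI x y hz
    refine (ha1 _ hz).unique ?_
    simpa only [pow_succ', mul_assoc] using (has.hasSum hI hz).mul_left ((x : ℍ[ℝ]) + y • I)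
  have hdisc : ∀ I ∈ imaginaryUnits, ∀ z ∈ ball (0 : ℂ) 1, (z.re, z.im) ∈ disc I :=
    fun I hI z hz => (mem_disc_iff hI _).2 hz
  have hq0 : ∀ I ∈ imaginaryUnits, ∀ z : ℂ, z ≠ 0 → (z.re : ℍ[ℝ]) + z.im • I ≠ 0 :=
    fun I hI z hz => by rw [← evalAt_coe]; exact evalAt_coe_ne_zero hI hz
  have hbound := norm_coeff_le_of_re_pos (a := a) rfl has.isHolomorphic_stem hhol.derivStem
    has.taylorCoeffQ_stem hD ?_ ?_ (k + 1)
  · have : a (k + 1) = p (k + 2) := rfl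
    rw [this] at hbound
    push_cast at hbound
    linarith
  · intro z hz I hI
    -- At the origin `f` vanishes and starlikeness says nothing, but there `A` has the value `a 0 =
    -- 1`.
    rcases eq_or_ne z 0 with rfl | hz0
    · rw [hA0]; exact one_ne_zero
    · intro h0
      have h1 := hfac I hI _ _ (hdisc I hI z hz)
      rw [Complex.eta, h0, mul_zero] at h1
      exact hq0 I hI z hz0 ((hf.zero_iff _ (hdisc I hI z hz)).1 h1)
  · intro z hz I hI
    rcases eq_or_ne z 0 with rfl | hz0
    · rw [hA0, hD0]; simp
    -- With `f = q g` the factor `q` cancels: `f⁻¹ q f' = g⁻¹ f'`.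
    · have h1 := hf.re_pos _ (hdisc I hI z hz) (hq0 I hI z hz0)
      rw [hind.sliceDeriv_eq hhol hI (hdisc I hI z hz), hfac I hI _ _ (hdisc I hI z hz),
        mul_inv_rev, mul_assoc, mul_assoc, inv_mul_cancel_left₀ (hq0 I hI z hz0)] at h1
      exact h1

/-! ### Evaluation of regular products and the Koebe function -/

/-- The power series `a` converges at `q` with sum `v`. -/
def HasEval (a : PowerSeries ℍ[ℝ]) (q v : ℍ[ℝ]) : Prop :=
  HasSum (fun k : ℕ => q ^ k * PowerSeries.coeff k a) v

theorem HasEval.eval_eq {a : PowerSeries ℍ[ℝ]} {q v : ℍ[ℝ]} (h : HasEval a q v) :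
    eval a q = v := h.tsum_eq

theorem hasEval_one (q : ℍ[ℝ]) : HasEval 1 q 1 := by
  have := hasSum_single (f := fun k : ℕ => q ^ k * PowerSeries.coeff k (1 : PowerSeries ℍ[ℝ])) 0
    (fun k hk => by simp [PowerSeries.coeff_one, hk])
  simpa [HasEval] using this

theorem HasEval.sub {a b : PowerSeries ℍ[ℝ]} {q v w : ℍ[ℝ]} (ha : HasEval a q v)
    (hb : HasEval b q w) : HasEval (a - b) q (v - w) := by
  simpa [HasEval, mul_sub] using HasSum.sub ha hb

theorem HasEval.mul_C {a : PowerSeries ℍ[ℝ]} {q v : ℍ[ℝ]} (ha : HasEval a q v) (c : ℍ[ℝ]) :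
    HasEval (a * PowerSeries.C c) q (v * c) := by
  simpa [HasEval, mul_assoc] using HasSum.mul_right c ha

theorem HasEval.X_mul {a : PowerSeries ℍ[ℝ]} {q v : ℍ[ℝ]} (ha : HasEval a q v) :
    HasEval (PowerSeries.X * a) q (q * v) := by
  have h := HasSum.mul_left q ha
  have h2 := (hasSum_nat_add_iff
    (f := fun k : ℕ => q ^ k * PowerSeries.coeff k (PowerSeries.X * a)) (g := q * v) 1).1
    (by simpa [PowerSeries.coeff_succ_X_mul, pow_succ', mul_assoc] using h)
  simpa [HasEval] using h2

/-- A right factor `1 - q c` acts on values as `x ↦ x - q x c`, so the Koebe function can be handled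
pointwise without conjugated arguments. -/
theorem HasEval.mul_one_sub {a : PowerSeries ℍ[ℝ]} {q v : ℍ[ℝ]} (ha : HasEval a q v)
    (c : ℍ[ℝ]) :
    HasEval (a * (1 - PowerSeries.X * PowerSeries.C c)) q (v - q * v * c) := by
  have : a * (1 - PowerSeries.X * PowerSeries.C c) = a - PowerSeries.X * a * PowerSeries.C c := by
    rw [mul_sub, mul_one, ← mul_assoc, (PowerSeries.commute_X a).eq]
  rw [this]
  exact ha.sub (ha.X_mul.mul_C c)

theorem regularConj_mul (a b : PowerSeries ℍ[ℝ]) :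
    regularConj (a * b) = regularConj b * regularConj a := by
  ext1 n
  simp only [regularConj, PowerSeries.coeff_mk, PowerSeries.coeff_mul, star_sum, star_mul]
  exact Finset.sum_equiv (Equiv.prodComm ℕ ℕ) (by simp [add_comm]) (by simp)

theorem regularConj_one_sub (c : ℍ[ℝ]) :
    regularConj (1 - PowerSeries.X * PowerSeries.C c) =
      1 - PowerSeries.X * PowerSeries.C (star c) := by
  ext1 n
  rw [regularConj, PowerSeries.coeff_mk]
  rcases n with _ | n
  · simp
  · simp only [map_sub, PowerSeries.coeff_succ_X_mul, PowerSeries.coeff_one, PowerSeries.coeff_C,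
      star_sub, apply_ite star, star_zero, star_one]

variable {u q : ℍ[ℝ]}

theorem mul_star_of_norm_eq_one (hu : ‖u‖ = 1) : u * star u = 1 := by
  rw [Quaternion.self_mul_star, Quaternion.normSq_eq_norm_mul_self, hu]
  simp

/-- The value of `(1 - q u) * (1 - q u)^c` is `1 - 2 Re(u) q + q ^ 2`, and multiplication by it
factors through the two operators `x ↦ x - q x u` and `x ↦ x - q x ū`. -/
theorem quadratic_mul (hu : ‖u‖ = 1) (q x : ℍ[ℝ]) :
    (1 - ((2 * u.re : ℝ) : ℍ[ℝ]) * q + q * q) * x =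
      (x - q * x * u) - q * (x - q * x * u) * star u := by
  have h1 : u * star u = 1 := mul_star_of_norm_eq_one hu
  have h2 : star u = ((2 * u.re : ℝ) : ℍ[ℝ]) - u := by
    rw [eq_sub_iff_add_eq', Quaternion.self_add_star']
  have h3 : q * (q * x * u) * star u = q * q * x := by
    simp only [mul_assoc, h1, mul_one]
  rw [mul_sub q x, sub_mul (q * x), h3, h2, mul_sub (q * x), ← Quaternion.coe_commutes]
  simp only [add_mul, sub_mul, one_mul, mul_assoc]
  abel

/-- `quadratic_mul` at `G` gives `1 - q ū`, which is nonzero since `‖q ū‖ < 1`. -/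
theorem quadratic_ne_zero (hu : ‖u‖ = 1) (hq : ‖q‖ < 1) {G : ℍ[ℝ]} (hG : G - q * G * u = 1) :
    1 - ((2 * u.re : ℝ) : ℍ[ℝ]) * q + q * q ≠ 0 := by
  intro h
  have h1 := quadratic_mul hu q G
  rw [h, hG, zero_mul, mul_one] at h1
  have h2 : ‖q * star u‖ = 1 := by
    rw [← sub_eq_zero.1 h1.symm, norm_one]
  rw [norm_mul, Quaternion.norm_star, hu, mul_one] at h2
  exact hq.ne h2

/-- `G` and `T` stand for the values of the regular reciprocals of `1 - q u` and of its square. The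
symmetrization evaluates to `n * n` and the regular conjugate to `n * n * T`, so `n * n` cancels. -/
theorem koebe_eq_mul (hu : ‖u‖ = 1) (hq : ‖q‖ < 1) {G T : ℍ[ℝ]} (hG : G - q * G * u = 1)
    (hT : T - q * T * u = G) : koebe u q = q * T := by
  set s : PowerSeries ℍ[ℝ] := 1 - PowerSeries.X * PowerSeries.C u with hs
  set t : PowerSeries ℍ[ℝ] := 1 - PowerSeries.X * PowerSeries.C (star u) with ht
  set n := 1 - ((2 * u.re : ℝ) : ℍ[ℝ]) * q + q * q with hn
  have hn0 : n ≠ 0 := quadratic_ne_zero hu hq hG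
  have hst : ∀ x v, HasEval x q v → HasEval (x * s * t) q (n * v) := by
    intro x v hx
    rw [quadratic_mul hu]
    exact (hx.mul_one_sub u).mul_one_sub (star u)
  have hconj : regularConj (s ^ 2) = t * t := by
    rw [sq, regularConj_mul, hs, regularConj_one_sub]
  have hcomm : s * t = t * s := by
    have hX : ∀ a : PowerSeries ℍ[ℝ], Commute a PowerSeries.X := fun a => PowerSeries.commute_X a
    have hC : Commute (PowerSeries.C u) (PowerSeries.C (star u)) := by
      rw [commute_iff_eq, ← map_mul, ← map_mul, star_comm_self' u]
    have h0 : Commute (PowerSeries.X * PowerSeries.C u) (PowerSeries.X * PowerSeries.C (star u)) :=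
      (hX _).mul_right ((hX _).symm.mul_left hC)
    exact ((Commute.one_left t).sub_left ((Commute.one_right _).sub_right h0)).eq
  have hsymm : symmetrization (s ^ 2) = 1 * s * t * s * t := by
    rw [symmetrization, hconj, sq, one_mul, mul_assoc s s, ← mul_assoc s t t, hcomm,
      ← mul_assoc, ← mul_assoc, ← hcomm]
  have h1 : eval (symmetrization (s ^ 2)) q = n * n := by
    rw [hsymm]
    simpa using (hst _ _ (hst _ _ (hasEval_one q))).eval_eq
  have h2 : eval (regularConj (s ^ 2)) q = n * n * T := by
    have h3 : HasEval (1 * t * t) q ((1 - q * 1 * star u) - q * (1 - q * 1 * star u) * star u) :=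
      ((hasEval_one q).mul_one_sub _).mul_one_sub _
    rw [one_mul] at h3
    have hnG : n * G = 1 - q * star u := by rw [quadratic_mul hu, hG, mul_one]
    have hcq : n * q = q * n := by
      exact (((Commute.one_left q).sub_left ((Quaternion.coe_commute _ q).mul_left
        (Commute.refl q))).add_left ((Commute.refl q).mul_left (Commute.refl q))).eq
    have hmul : n * (G - q * G * star u) = n * G - n * q * G * star u := by
      simp only [mul_sub, mul_assoc]
    rw [hconj, h3.eval_eq, mul_one, ← hnG, mul_assoc n n T, quadratic_mul hu q T, hT, hmul, hcq,
      mul_assoc q n G]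
  rw [koebe, regularRecip, h1, h2, inv_mul_cancel_left₀ (mul_ne_zero hn0 hn0)]

/-! ### Expansion and starlikeness of the Koebe function -/

/-- The coefficients of the quaternionic Koebe function. -/
def koebeCoeff (u : ℍ[ℝ]) (k : ℕ) : ℍ[ℝ] := (k : ℍ[ℝ]) * u ^ (k - 1)

theorem norm_koebeCoeff (hu : ‖u‖ = 1) (k : ℕ) : ‖koebeCoeff u k‖ = k := by
  rw [koebeCoeff, norm_mul, norm_pow, hu, one_pow, mul_one, ← Quaternion.coe_natCast,
    Quaternion.norm_coe, Real.norm_natCast]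

theorem summableOnBall_koebeCoeff (hu : ‖u‖ = 1) : SummableOnBall (koebeCoeff u) := by
  intro r h0 h1
  simp only [norm_koebeCoeff hu]
  exact (hasSum_coe_mul_geometric_of_norm_lt_one (by rwa [Real.norm_of_nonneg h0])).summable

theorem exists_koebe_sums (hu : ‖u‖ = 1) (hq : ‖q‖ < 1) :
    ∃ G T : ℍ[ℝ], G - q * G * u = 1 ∧ T - q * T * u = G ∧
      HasSum (fun k : ℕ => q ^ k * koebeCoeff u (k + 1)) T := by
  have hs : Summable fun k : ℕ => q ^ k * u ^ k := by
    refine Summable.of_norm ?_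
    simp only [norm_mul, norm_pow, hu, one_pow, mul_one]
    exact summable_geometric_of_lt_one (norm_nonneg q) hq
  have ht : Summable fun k : ℕ => q ^ k * koebeCoeff u (k + 1) := by
    refine Summable.of_norm ?_
    simp only [norm_mul, norm_pow, norm_koebeCoeff hu]
    have h1 := summable_geometric_of_lt_one (norm_nonneg q) hq
    have h2 := (hasSum_coe_mul_geometric_of_norm_lt_one (r := ‖q‖) (by rwa [norm_norm])).summable
    refine (h2.add h1).congr fun k => ?_
    push_cast
    ring
  obtain ⟨G, hG⟩ := hs
  obtain ⟨T, hT⟩ := ht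
  have hG1 : HasSum (fun k : ℕ => q ^ (k + 1) * u ^ (k + 1)) (G - 1) := by
    simpa using (hasSum_nat_add_iff' 1).2 hG
  have hT1 : HasSum (fun k : ℕ => q ^ (k + 1) * koebeCoeff u (k + 1 + 1)) (T - 1) := by
    simpa [koebeCoeff] using (hasSum_nat_add_iff' 1).2 hT
  have hG2 : HasSum (fun k : ℕ => q ^ (k + 1) * u ^ (k + 1)) (q * G * u) := by
    refine ((hG.mul_left q).mul_right u).congr_fun fun k => ?_
    rw [pow_succ', pow_succ]
    simp only [mul_assoc]
  have hT2 : HasSum (fun k : ℕ => q ^ (k + 1) * koebeCoeff u (k + 1 + 1))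
      (q * T * u + (G - 1)) := by
    refine (((hT.mul_left q).mul_right u).add hG1).congr_fun fun k => ?_
    simp only [koebeCoeff, Nat.add_sub_cancel]
    push_cast
    rw [pow_succ' q, pow_succ u]
    simp only [mul_assoc, add_mul, mul_add, one_mul]
  refine ⟨G, T, ?_, ?_, hT⟩
  · rw [← hG1.unique hG2]; abel
  · have := hT1.unique hT2
    rw [← sub_eq_zero] at this ⊢
    rw [← this]; abel

theorem hasSum_koebe (hu : ‖u‖ = 1) (hq : ‖q‖ < 1) :
    HasSum (fun k : ℕ => q ^ k * koebeCoeff u k) (koebe u q) := by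
  obtain ⟨G, T, hG, hT, hTs⟩ := exists_koebe_sums hu hq
  rw [koebe_eq_mul hu hq hG hT]
  have h := (hasSum_nat_add_iff (f := fun k : ℕ => q ^ k * koebeCoeff u k) (g := q * T) 1).1
    (by simpa [pow_succ', mul_assoc] using hTs.mul_left q)
  simpa [koebeCoeff] using h

/-- The functional equation `f * (1 - q u) * (1 - q u) = q` of the Koebe function. -/
theorem koebe_functional_equation (hu : ‖u‖ = 1) (hq : ‖q‖ < 1) :
    (koebe u q - q * koebe u q * u) - q * (koebe u q - q * koebe u q * u) * u = q := by
  obtain ⟨G, T, hG, hT, -⟩ := exists_koebe_sums hu hq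
  have h1 : q * T - q * (q * T) * u = q * G := by rw [← hT]; simp only [mul_sub, mul_assoc]
  rw [koebe_eq_mul hu hq hG hT, h1]
  calc q * G - q * (q * G) * u = q * (G - q * G * u) := by simp only [mul_sub, mul_assoc]
    _ = q := by rw [hG, mul_one]

/-- The map `x ↦ q x u` scales norms by `‖q‖ < 1`, so `0` is its only fixed point. -/
theorem eq_zero_of_eq_mul_mul (hu : ‖u‖ = 1) (hq : ‖q‖ < 1) {x : ℍ[ℝ]} (h : x - q * x * u = 0) :
    x = 0 := by
  have h1 : ‖x‖ = ‖q‖ * ‖x‖ := by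
    conv_lhs => rw [sub_eq_zero.1 h]
    rw [norm_mul, norm_mul, hu, mul_one]
  rw [← norm_le_zero_iff]
  nlinarith [norm_nonneg x]

theorem isInduced_koebe (hu : ‖u‖ = 1) : IsInduced (koebe u) (stem (koebeCoeff u)) :=
  (summableOnBall_koebeCoeff hu).isInduced fun _ hq => hasSum_koebe hu hq

theorem IsInduced.hasDerivAt {f : ℍ[ℝ] → ℍ[ℝ]} {F : ℂ → ℍ[ℂ]} (h : IsInduced f F)
    (hF : IsHolomorphic F) {I : ℍ[ℝ]} (hI : I ∈ imaginaryUnits) {x y : ℝ} (hz : (x, y) ∈ disc I) :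
    HasDerivAt (fun t : ℝ => f ((t : ℍ[ℝ]) + y • I)) (sliceDeriv f ((x : ℍ[ℝ]) + y • I)) x := by
  obtain ⟨L, hL, -⟩ := h.hasFDerivAt hF hI hz
  rw [h.sliceDeriv_eq_partialX hF hI hz, partialX, hL.fderiv]
  exact hL.comp_hasDerivAt x ((hasDerivAt_id x).prodMk (hasDerivAt_const x y))

/-- The two differentiated forms of the functional equation of the Koebe function. -/
theorem koebe_deriv_equation (hu : ‖u‖ = 1) (hq : ‖q‖ < 1) :
    ∃ d : ℍ[ℝ], d = sliceDeriv (koebe u) q -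
        (koebe u q + q * sliceDeriv (koebe u) q) * u ∧
      d - ((koebe u q - q * koebe u q * u) + q * d) * u = 1 := by
  refine ⟨_, rfl, ?_⟩
  obtain ⟨I, hI, x, y, rfl⟩ : ∃ I ∈ imaginaryUnits, ∃ x y : ℝ, q = (x : ℍ[ℝ]) + y • I :=
    ⟨unitOf q, unitOf_mem q, q.re, ‖q.im‖, (re_add_norm_im_smul_unitOf q).symm⟩
  have hz : (x, y) ∈ disc I := hq
  have hf := (isInduced_koebe hu).hasDerivAt (summableOnBall_koebeCoeff hu).isHolomorphic_stem hI hz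
  have hid : HasDerivAt (fun t : ℝ => (t : ℍ[ℝ]) + y • I) 1 x := by
    have h1 : HasDerivAt (fun t : ℝ => t • (1 : ℍ[ℝ])) ((1 : ℝ) • (1 : ℍ[ℝ])) x :=
      (hasDerivAt_id x).smul_const 1
    have h2 : (fun t : ℝ => (t : ℍ[ℝ]) + y • I) = fun t : ℝ => t • (1 : ℍ[ℝ]) + y • I := by
      funext t
      rw [← Quaternion.coe_one, Quaternion.smul_coe, mul_one]
    rw [h2]
    simpa using h1.add_const (y • I)
  -- Along the real direction `q` has derivative `1`, so the ordinary product rule applies despite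
  -- noncommutativity.
  have hg := hf.fun_sub ((hid.fun_mul hf).mul_const u)
  have hk := hg.fun_sub ((hid.fun_mul hg).mul_const u)
  have hopen : ∀ᶠ t : ℝ in nhds x, (t, y) ∈ disc I :=
    (Continuous.prodMk continuous_id continuous_const).continuousAt.eventually
      ((isOpen_disc hI).mem_nhds hz)
  have hk' := hk.congr_of_eventuallyEq (f₁ := fun t : ℝ => (t : ℍ[ℝ]) + y • I)
    (hopen.mono fun t ht => (koebe_functional_equation hu ht).symm)
  have := hk'.unique hid
  simpa only [one_mul] using this

/-- The equation rearranges to `w - 1 = p (w + 1) u`: the Cayley transform. Hence `‖w - 1‖ < ‖w +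
1‖`, which means `0 < w.re`. -/
theorem re_pos_of_sub_eq {p w : ℍ[ℝ]} (hu : ‖u‖ = 1) (hp : ‖p‖ < 1)
    (h : w - p * w * u = 1 + p * u) : 0 < w.re := by
  have h1 : w - 1 = p * (w + 1) * u := by
    calc w - 1 = w - p * w * u + p * w * u - 1 := by abel
      _ = p * (w + 1) * u := by rw [h, mul_add, add_mul, mul_one]; abel
  have h2 : ‖w - 1‖ = ‖p‖ * ‖w + 1‖ := by rw [h1, norm_mul, norm_mul, hu, mul_one]
  have h3 : ‖w + 1‖ ^ 2 - ‖w - 1‖ ^ 2 = 4 * w.re := by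
    rw [← sum_sq_eq_norm_sq, ← sum_sq_eq_norm_sq]
    simp
    ring
  have h4 : ‖w + 1‖ ≠ 0 := by
    intro h5
    rw [h5, mul_zero] at h2
    have h6 : w + 1 = 0 := norm_eq_zero.1 h5
    have h7 : w - 1 = 0 := norm_eq_zero.1 h2
    have h8 := congrArg (fun a : ℍ[ℝ] => a.re) h6
    have h9 := congrArg (fun a : ℍ[ℝ] => a.re) h7
    simp at h8 h9
    linarith
  have h5 : 0 < ‖w + 1‖ := lt_of_le_of_ne (norm_nonneg _) h4.symm
  have h6 : ‖w - 1‖ < ‖w + 1‖ := by rw [h2]; nlinarith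
  nlinarith [norm_nonneg (w - 1)]

theorem koebe_zero (u : ℍ[ℝ]) : koebe u 0 = 0 := by rw [koebe, zero_mul]

theorem eq_zero_of_koebe_eq_zero (hu : ‖u‖ = 1) (hq : ‖q‖ < 1) (h : koebe u q = 0) : q = 0 := by
  have h1 := koebe_functional_equation hu hq
  simpa [h] using h1.symm

theorem isSliceStarlike_koebe (hu : ‖u‖ = 1) : IsSliceStarlike (koebe u) where
  sliceRegular := (isInduced_koebe hu).isSliceRegular
    (summableOnBall_koebeCoeff hu).isHolomorphic_stem
  sliceDeriv_zero := by
    obtain ⟨d, h1, h2⟩ := koebe_deriv_equation (q := 0) hu (by simp)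
    simp only [koebe_zero, zero_mul, add_zero, sub_zero] at h1 h2
    rw [← h1, h2]
  zero_iff q hq := ⟨eq_zero_of_koebe_eq_zero hu hq, fun h => h ▸ koebe_zero u⟩
  re_pos q hq hq0 := by
    have hf0 : koebe u q ≠ 0 := fun h => hq0 (eq_zero_of_koebe_eq_zero hu hq h)
    have hfe := koebe_functional_equation hu hq
    obtain ⟨d, hd, hde⟩ := koebe_deriv_equation hu hq
    set f := koebe u q
    set f' := sliceDeriv (koebe u) q
    -- Multiplying the differentiated equation by `q` and using the original one shows that `q d -
    -- f` is fixed by `x ↦ q x u`.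
    have hqd : q * d = f := by
      rw [← sub_eq_zero]
      refine eq_zero_of_eq_mul_mul hu hq ?_
      have h1 := congrArg (q * ·) hde
      simp only [mul_one] at h1
      refine Eq.trans ?_ (sub_eq_zero.2 (h1.trans hfe.symm))
      simp only [mul_sub, sub_mul, mul_add, add_mul, mul_assoc]
      abel
    have hh : q * f' - q * (q * f') * u = f + q * f * u := by
      rw [hd, ← sub_eq_zero] at hqd
      rw [← sub_eq_zero]
      refine Eq.trans ?_ hqd
      simp only [mul_sub, add_mul, mul_add, mul_assoc]
      abel
    -- Multiplying `hh` by `f⁻¹` turns `q` into its conjugate `f⁻¹ q f`, of the same norm.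
    have hp : ‖f⁻¹ * q * f‖ < 1 := by
      rw [norm_mul, norm_mul, norm_inv, mul_right_comm, inv_mul_cancel₀ (norm_ne_zero_iff.2 hf0),
        one_mul]
      exact hq
    refine re_pos_of_sub_eq hu hp ?_
    have h1 := congrArg (f⁻¹ * ·) hh
    simp only [mul_sub, mul_add, inv_mul_cancel₀ hf0, ← mul_assoc] at h1
    rw [← h1]
    simp only [mul_assoc, mul_inv_cancel_left₀ hf0]

/-! ### The majorant series and the Bohr radius -/

theorem hasSum_nat_mul_pow {r : ℝ} (h0 : 0 ≤ r) (h1 : r < 1) :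
    HasSum (fun k : ℕ => r ^ (k + 2) * ((k : ℝ) + 2)) (r / (1 - r) ^ 2 - r) := by
  have h := (hasSum_nat_add_iff' 2).2
    (hasSum_coe_mul_geometric_of_norm_lt_one (r := r) (by rwa [Real.norm_of_nonneg h0]))
  simp only [Finset.sum_range_succ, Finset.sum_range_zero] at h
  push_cast at h
  simpa [mul_comm] using h

theorem bohr_radius_bounds : 0 < (3 - √5) / 2 ∧ (3 - √5) / 2 < 1 := by
  have h1 : √5 < 3 := (Real.sqrt_lt' (by norm_num)).2 (by norm_num)
  have h2 : 1 < √5 := (Real.lt_sqrt (by norm_num)).2 (by norm_num)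
  constructor <;> linarith

theorem div_one_sub_sq_le_one {r : ℝ} (hr : r ≤ (3 - √5) / 2) : r / (1 - r) ^ 2 ≤ 1 := by
  have h1 := bohr_radius_bounds
  have h5 : √5 * √5 = 5 := Real.mul_self_sqrt (by norm_num)
  rw [div_le_one (by nlinarith)]
  nlinarith

/-- The other root of `r ^ 2 - 3 r + 1` exceeds `1`, so the polynomial is negative on the whole
interval. -/
theorem one_lt_div_one_sub_sq {r : ℝ} (hr : (3 - √5) / 2 < r) (hr1 : r < 1) :
    1 < r / (1 - r) ^ 2 := by
  have h1 := bohr_radius_bounds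
  have h5 : √5 * √5 = 5 := Real.mul_self_sqrt (by norm_num)
  rw [one_lt_div (by nlinarith)]
  nlinarith

end SliceStarlike

end

theorem theorem1p1 :
    (∀ (f : ℍ[ℝ] → ℍ[ℝ]) (p : ℕ → ℍ[ℝ]), SliceStarlike.IsSliceStarlike f →
      (∀ q : ℍ[ℝ], ‖q‖ < 1 → HasSum (fun k : ℕ => q ^ (k + 2) * p (k + 2)) (f q - q)) →
      ∀ q : ℍ[ℝ], ‖q‖ ≤ (3 - √5) / 2 →
        Summable (fun k : ℕ => ‖q ^ (k + 2) * p (k + 2)‖) ∧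
        ‖q‖ + ∑' k : ℕ, ‖q ^ (k + 2) * p (k + 2)‖ ≤ 1) ∧
    (∀ u : ℍ[ℝ], ‖u‖ = 1 →
      SliceStarlike.IsSliceStarlike (SliceStarlike.koebe u) ∧
      (∀ q : ℍ[ℝ], ‖q‖ < 1 →
        HasSum (fun k : ℕ => q ^ (k + 2) * (((k + 2 : ℕ) : ℍ[ℝ]) * u ^ (k + 1)))
          (SliceStarlike.koebe u q - q)) ∧
      ∀ q : ℍ[ℝ], (3 - √5) / 2 < ‖q‖ → ‖q‖ < 1 →
        Summable (fun k : ℕ => ‖q ^ (k + 2) * (((k + 2 : ℕ) : ℍ[ℝ]) * u ^ (k + 1))‖) ∧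
        1 < ‖q‖ + ∑' k : ℕ, ‖q ^ (k + 2) * (((k + 2 : ℕ) : ℍ[ℝ]) * u ^ (k + 1))‖) := by
  refine ⟨fun f p hf hp q hq => ?_, fun u hu => ⟨SliceStarlike.isSliceStarlike_koebe hu,
    fun q hq => ?_, fun q hq hq1 => ?_⟩⟩
  · have hq1 : ‖q‖ < 1 := hq.trans_lt SliceStarlike.bohr_radius_bounds.2
    have hS := SliceStarlike.hasSum_nat_mul_pow (norm_nonneg q) hq1
    have hle : ∀ k : ℕ, ‖q ^ (k + 2) * p (k + 2)‖ ≤ ‖q‖ ^ (k + 2) * ((k : ℝ) + 2) := fun k => by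
      rw [norm_mul, norm_pow]
      exact mul_le_mul_of_nonneg_left (hf.norm_coeff_le hp k) (by positivity)
    have hs := hS.summable.of_nonneg_of_le (fun _ => norm_nonneg _) hle
    refine ⟨hs, ?_⟩
    have h1 := hasSum_le hle hs.hasSum hS
    have h2 := SliceStarlike.div_one_sub_sq_le_one hq
    linarith
  · have h := (hasSum_nat_add_iff' 2).2 (SliceStarlike.hasSum_koebe hu hq)
    simpa [SliceStarlike.koebeCoeff, Finset.sum_range_succ] using h
  · have hS := SliceStarlike.hasSum_nat_mul_pow (norm_nonneg q) hq1
    have heq : ∀ k : ℕ, ‖q ^ (k + 2) * (((k + 2 : ℕ) : ℍ[ℝ]) * u ^ (k + 1))‖ =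
        ‖q‖ ^ (k + 2) * ((k : ℝ) + 2) := fun k => by
      have h1 := SliceStarlike.norm_koebeCoeff hu (k + 2)
      rw [SliceStarlike.koebeCoeff] at h1
      rw [norm_mul, norm_pow, show k + 1 = k + 2 - 1 from rfl, h1]
      push_cast
      rfl
    simp only [heq]
    refine ⟨hS.summable, ?_⟩
    rw [hS.tsum_eq]
    have h2 := SliceStarlike.one_lt_div_one_sub_sq hq hq1
    linarith
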